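/- Let $\tau$ be in the upper half-plane, $\Lambda=\mathbb Z+\mathbb Z\tau$, $\mathbb T=\mathbb C/\Lambda$, let $\wp$ be the Weierstrass function with periods $1,\tau$, and let $\gamma$ be the segment from $\tau/2$ to $\tau/2+1$, oriented in this direction. The weight is ${\sf w}\equiv 1$. Put $\mathcal E_{2k}=\wp^k$, $\mathcal E_{2k+3}=-\tfrac12\wp'\wp^k$ ($k\ge0$), $\mu_{i,j}=\int_\gamma\mathcal E_i\mathcal E_j\,dz$ and $D_m=\det(\mu_{i,j})_{i,j\in\{0,2,3,\dots,m-1\}}$. For $m\ge2$ let $\pi_m$ denote the elliptic orthogonal polynomial of degree $m$: an elliptic function with periods $1,\tau$ whose poles all lie in $\Lambda$, with $\pi_m(z)=z^{-m}(1+\mathcal O(z))$ as $z\to0$ and $\int_\gamma\pi_m\mathcal E_j\,dz=0$ for all $j<m$, $j\neq1$. Put $h_m=\int_\gamma\pi_m^2\,dz$. Let $Y_m$ be the solution of the Riemann–Hilbert problem of index $m$: $Y_m$ is a $2\times2$ matrix function, analytic on $\mathbb T\setminus(\gamma\cup\{0\})$, with boundary values on $\gamma$ satisfying $Y_{m,+}=Y_{m,-}\begin{pmatrix}1&1\\0&1\end{pmatrix}$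 ($+$ is the left side of $\gamma$), and $Y_m(z)=(\mathbb 1+\mathcal O(z))\begin{pmatrix}z^{-m}&0\\0&z^{m-2}\end{pmatrix}$ as $z\to0$. Put $f_m=\det Y_m$. **Proposition.** Let $n\ge3$ and suppose that $D_{n-1}$, $D_n$ and $D_{n+1}$ are nonzero. Then $h_{n-1}\ne0$, $h_n\neq0$, each $f_m$ with $m\in\{n-1,n,n+1\}$ has the form $f_m=\wp+\alpha_m$ with a constant $\alpha_m$ (and so extends to $\mathbb C\setminus\Lambda$), and $$Y_n'=L_nY_n,\qquad L_n=\frac1{f_n}\begin{pmatrix} \tfrac n2\wp' & \frac{h_n}{2\pi i}\big((n-1)f_n+nf_{n+1}\big)\\[2pt] \frac{2\pi i}{h_{n-1}}\big((2-n)f_{n-1}+(1-n)f_n\big) & \tfrac{2-n}2\wp'\end{pmatrix}$$ at every point of $\mathbb T\setminus(\gamma\cup\{0\})$ where $f_n\ne0$, where ${}'=d/dz$. Moreover, at every $z\notin\Lambda$ with $f_n(z)\neq0$ and $(n-1)f_n(z)+nf_{n+1}(z)\ne0$, $$\pi_n''=\Big(\frac{\wp'}{f_n}+n\Big(\frac{f_{n+1}}{f_n}\Big)'\Big((n-1)+n\frac{f_{n+1}}{f_n}\Big)^{-1}\Big)\pi_n'+\Big(\Big(\frac{n\wp'}{2f_n}\Big)'-n\Big(\frac{f_{n+1}}{f_n}\Big)'\frac{n\wp'}{2\big((n-1)f_n+nf_{n+1}\big)}-\det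 L_n\Big)\pi_n .$$ -/

import Mathlib

open Filter Topology Asymptotics

noncomputable section

namespace EllipticOP

/-- The pair of periods `(1, τ)`, for `τ` in the upper half-plane. -/
def periods (τ : UpperHalfPlane) : PeriodPair where
  ω₁ := 1
  ω₂ := (τ : ℂ)
  indep := by
    rw [LinearIndependent.pair_iff]
    intro s t h
    have him := congrArg Complex.im h
    have hre := congrArg Complex.re h
    have hτ : (τ : ℂ).im ≠ 0 := τ.im_ne_zero
    simp only [Complex.real_smul, mul_one, Complex.add_im, Complex.ofReal_im, Complex.mul_im,
      Complex.ofReal_re, zero_mul, add_zero, zero_add, Complex.zero_im, mul_eq_zero, hτ,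
      or_false] at him
    subst him
    simpa using hre

/-- The lattice `ℤ + ℤ τ`, as a set of complex numbers. -/
def latticeSet (τ : UpperHalfPlane) : Set ℂ := ((periods τ).lattice : Set ℂ)

/-- The Weierstrass function `℘` with periods `1` and `τ`. -/
def wp (τ : UpperHalfPlane) (z : ℂ) : ℂ := (periods τ).weierstrassP z

/-- The `z`-derivative `℘'` of the Weierstrass function with periods `1` and `τ`. -/
def wp' (τ : UpperHalfPlane) (z : ℂ) : ℂ := (periods τ).derivWeierstrassP z

/-- The integral `∫_γ g(z) dz` over the segment `γ` from `τ/2` to `τ/2 + 1`. -/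
def gammaIntegral (τ : UpperHalfPlane) (g : ℂ → ℂ) : ℂ :=
  ∫ t in (0 : ℝ)..1, g ((τ : ℂ) / 2 + (t : ℂ))

/-- The basis functions `𝓔₂ₖ = ℘ᵏ` and `𝓔₂ₖ₊₃ = -½ ℘' ℘ᵏ`. The index `1` is never used. -/
def ellBasis (τ : UpperHalfPlane) (m : ℕ) (z : ℂ) : ℂ :=
  if Even m then wp τ z ^ (m / 2) else -(1 / 2) * wp' τ z * wp τ z ^ ((m - 3) / 2)

/-- The moments `μᵢⱼ = ∫_γ 𝓔ᵢ 𝓔ⱼ dz` for the weight `1`. -/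
def moment (τ : UpperHalfPlane) (i j : ℕ) : ℂ :=
  gammaIntegral τ (fun z => ellBasis τ i z * ellBasis τ j z)

/-- The increasing enumeration `0, 2, 3, 4, …` of the natural numbers different from `1`. -/
def idx (i : ℕ) : ℕ := if i = 0 then 0 else i + 1

/-- The determinant `Dₙ` of the moments `μᵢⱼ` with `i, j ∈ {0, 2, 3, …, n - 1}`. -/
def momentDet (τ : UpperHalfPlane) (n : ℕ) : ℂ :=
  (Matrix.of fun i j : Fin (n - 1) => moment τ (idx i) (idx j)).det

/-- `p` is a monic elliptic polynomial of degree `n`: an elliptic function with periods `1` and `τ`,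
all of whose poles lie on the lattice, with `p(z) = z⁻ⁿ (1 + O(z))` as `z → 0`.
(The values that Lean's total function `p` takes at lattice points are irrelevant.) -/
structure IsMonicEllipticPolynomial (τ : UpperHalfPlane) (n : ℕ) (p : ℂ → ℂ) : Prop where
  differentiableOn : DifferentiableOn ℂ p (latticeSet τ)ᶜ
  add_one : ∀ z ∉ latticeSet τ, p (z + 1) = p z
  add_tau : ∀ z ∉ latticeSet τ, p (z + (τ : ℂ)) = p z
  monic : (fun z : ℂ => z ^ n * p z - 1) =O[𝓝[≠] 0] (fun z : ℂ => z)

/-- `p` is the `n`-th elliptic orthogonal polynomial `πₙ` for the weight `1`: it is monic of degree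
`n` and orthogonal on `γ` to all elliptic polynomials of smaller degree. -/
structure IsEOP (τ : UpperHalfPlane) (n : ℕ) (p : ℂ → ℂ) : Prop
    extends IsMonicEllipticPolynomial τ n p where
  orthogonal : ∀ m < n, m ≠ 1 → gammaIntegral τ (fun z => p z * ellBasis τ m z) = 0

/-- The preimage in `ℂ` of the closed curve `γ` on the torus `ℂ / (ℤ + ℤ τ)`: the union of the
horizontal lines `ℝ + (k + 1/2) τ`, `k ∈ ℤ`. -/
def contour (τ : UpperHalfPlane) : Set ℂ :=
  {z | ∃ (t : ℝ) (k : ℤ), z = (t : ℂ) + ((k : ℂ) + 1 / 2) * (τ : ℂ)}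

/-- The preimage in `ℂ` of the torus with `γ` and `0` removed. -/
def domain (τ : UpperHalfPlane) : Set ℂ := (latticeSet τ ∪ contour τ)ᶜ

/-- `Y` solves the Riemann-Hilbert problem of index `n` with weight `1`. A function on the torus
minus `γ ∪ {0}` is written as a doubly periodic function on `domain τ`; `γ` is oriented
from `τ/2` to `τ/2 + 1`, so that its left side (`+`) is the upper one. -/
structure IsRHPSolution (τ : UpperHalfPlane) (n : ℕ) (Y : ℂ → Matrix (Fin 2) (Fin 2) ℂ) :
    Prop where
  analytic : ∀ i j, AnalyticOnNhd ℂ (fun z => Y z i j) (domain τ)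
  add_one : ∀ z ∈ domain τ, Y (z + 1) = Y z
  add_tau : ∀ z ∈ domain τ, Y (z + (τ : ℂ)) = Y z
  jump : ∀ t ∈ Set.Icc (0 : ℝ) 1, ∃ Yplus Yminus : Matrix (Fin 2) (Fin 2) ℂ,
    Tendsto Y (𝓝[{z : ℂ | (τ : ℂ).im / 2 < z.im}] ((τ : ℂ) / 2 + (t : ℂ))) (𝓝 Yplus) ∧
    Tendsto Y (𝓝[{z : ℂ | z.im < (τ : ℂ).im / 2}] ((τ : ℂ) / 2 + (t : ℂ))) (𝓝 Yminus) ∧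
    Yplus = Yminus * !![1, 1; 0, 1]
  /-- `Y(z) = (1 + O(z)) diag(z⁻ⁿ, zⁿ⁻²)` as `z → 0`. -/
  asymptotic : ∀ i j,
    (fun z : ℂ => (Y z * !![z ^ (n : ℤ), 0; 0, z ^ (2 - (n : ℤ))] - 1) i j)
      =O[𝓝[≠] 0] (fun z : ℂ => z)

/-- The matrix `Lₙ(z)`, for given values `fprev = fₙ₋₁(z)`, `f = fₙ(z)`, `fnext = fₙ₊₁(z)`,
`d = ℘'(z)`, `hprev = hₙ₋₁` and `h = hₙ`. -/
def laxMatrix (n : ℕ) (hprev h fprev f fnext d : ℂ) : Matrix (Fin 2) (Fin 2) ℂ :=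
  (1 / f) • !![(n : ℂ) * d / 2,
      h / (2 * Real.pi * Complex.I) * (((n : ℂ) - 1) * f + (n : ℂ) * fnext);
    2 * Real.pi * Complex.I / hprev * ((2 - (n : ℂ)) * fprev + (1 - (n : ℂ)) * f),
      (2 - (n : ℂ)) * d / 2]

end EllipticOP

end

/-! The jump matrix is constant, so a row of $Y_m$ can be continued across $\gamma$. The first entry
$x$ becomes elliptic, and the second becomes a function $y$, holomorphic off the lattice, with
$y(z+1)=y(z)$ and $y(z+\tau)=y(z)-x(z)$ (`IsJumpPair`, `exists_isJumpPair`). Such pairs are closed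
under linear combination, $d/dz$ and the reflection $(x(-z),-y(-z))$, and the $2\times2$ minor of
two pairs is elliptic. Everything then follows from orders at $0$, recorded by `HasLead`.

The main tool is a uniqueness statement, `IsJumpPair.eq_const_mul`. Let $D_m\ne0$ and let $(a,b)$ be
the first row of $Y_m$. Any pair with orders at least $-m$ and $m-1$ at $0$ is a multiple of
$(a,b)$. To see this, subtract the multiple that removes the leading pole. By the residue theorem on
a period strip, $\int_\gamma x\,\mathcal E_j\,dz=2\pi i\,\mathrm{Res}_0(y\,\mathcal E_j)=0$ for
$j<m$, so the moment matrix forces $x=0$. Then $y$ is elliptic without poles and vanishes at $0$,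
hence $y=0$.

Write $b\sim\kappa_mz^{m-1}$ and $Y_m=\begin{pmatrix}a&b\\c&d\end{pmatrix}$. Then $h_m=2\pi
i\kappa_m$. Uniqueness has three consequences: the second row of $Y_{m+1}$ is $\kappa_m^{-1}(a,b)$,
and in particular $\kappa_m\neq0$; $(a,b)$ has definite parity; $(a,b)'+m\cdot(\text{first row of
}Y_{m+1})-(m-1)\kappa_m(c,d)$ is a multiple of $(a,b)$.

The entries of $Y_n'\,\mathrm{adj}\,Y_n=f_nL_n$ can now be read off. The off-diagonal ones are
minors of neighbouring rows, that is, combinations of $f_{n-1},f_n,f_{n+1}$. The upper diagonal one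
is odd and elliptic with a triple pole, hence a multiple of $\wp'$, and the lower one follows from
$f_n'=\wp'$. The second-order equation comes from eliminating the second entry of the first column.
-/

namespace EllipticOP

/-! ### Leading Laurent coefficients at the origin -/

/-- `g` is meromorphic at `0`, with `g(z) = c zᵏ (1 + O(z))` if `c ≠ 0`, and of order greater
than `k` if `c = 0`. -/
def HasLead (g : ℂ → ℂ) (k : ℤ) (c : ℂ) : Prop :=
  ∃ φ : ℂ → ℂ, AnalyticAt ℂ φ 0 ∧ φ 0 = c ∧ ∀ᶠ z in 𝓝[≠] (0 : ℂ), g z = z ^ k * φ z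

namespace HasLead

variable {g h : ℂ → ℂ} {k l : ℤ} {c d : ℂ}

theorem congr (hg : HasLead g k c) (e : ∀ᶠ z in 𝓝[≠] (0 : ℂ), h z = g z) : HasLead h k c := by
  obtain ⟨φ, hφ, h0, hz⟩ := hg
  exact ⟨φ, hφ, h0, by filter_upwards [hz, e] with z h1 h2; rw [h2, h1]⟩

theorem tendsto (hg : HasLead g k c) :
    Tendsto (fun z => z ^ (-k) * g z) (𝓝[≠] (0 : ℂ)) (𝓝 c) := by
  obtain ⟨φ, hφ, h0, hz⟩ := hg
  have h1 : Tendsto φ (𝓝[≠] (0 : ℂ)) (𝓝 c) :=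
    h0 ▸ hφ.continuousAt.tendsto.mono_left nhdsWithin_le_nhds
  refine h1.congr' ?_
  filter_upwards [hz, self_mem_nhdsWithin] with z h1 h2
  have h2 : z ≠ 0 := h2
  rw [h1, ← mul_assoc, ← zpow_add₀ h2]
  simp

theorem unique (hg : HasLead g k c) (hg' : HasLead g k d) : c = d :=
  tendsto_nhds_unique hg.tendsto hg'.tendsto

/-- Riemann's removable singularity theorem, applied to $z^{-k}g(z)$ with the limit as its value at
$0$. -/
theorem of_tendsto (hd : ∀ᶠ z in 𝓝[≠] (0 : ℂ), DifferentiableAt ℂ g z)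
    (ht : Tendsto (fun z => z ^ (-k) * g z) (𝓝[≠] (0 : ℂ)) (𝓝 c)) : HasLead g k c := by
  refine ⟨Function.update (fun z => z ^ (-k) * g z) 0 c, ?_, by simp, ?_⟩
  · apply Complex.analyticAt_of_differentiable_on_punctured_nhds_of_continuousAt
    · filter_upwards [hd, self_mem_nhdsWithin] with z h1 h2
      have h2 : z ≠ 0 := h2
      have : DifferentiableAt ℂ (fun z => z ^ (-k) * g z) z :=
        (differentiableAt_zpow.2 (Or.inl h2)).mul h1
      refine this.congr_of_eventuallyEq ?_
      filter_upwards [isOpen_ne.mem_nhds h2] with w hw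
      rw [Function.update_of_ne hw]
    · exact continuousAt_update_same.2 ht
  · filter_upwards [self_mem_nhdsWithin] with z h2
    have h2 : z ≠ 0 := h2
    rw [Function.update_of_ne h2, ← mul_assoc, ← zpow_add₀ h2]
    simp

theorem of_isBigO (hd : ∀ᶠ z in 𝓝[≠] (0 : ℂ), DifferentiableAt ℂ g z)
    (ho : (fun z => z ^ (-k) * g z - c) =O[𝓝[≠] (0 : ℂ)] (fun z => z)) : HasLead g k c := by
  refine of_tendsto hd ?_
  have h0 : Tendsto (fun z : ℂ => z) (𝓝[≠] (0 : ℂ)) (𝓝 0) := nhdsWithin_le_nhds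
  simpa using (ho.trans_tendsto h0).add_const c

theorem mul (hg : HasLead g k c) (hh : HasLead h l d) :
    HasLead (fun z => g z * h z) (k + l) (c * d) := by
  obtain ⟨φ, hφ, h0, hz⟩ := hg
  obtain ⟨ψ, hψ, h0', hz'⟩ := hh
  refine ⟨fun z => φ z * ψ z, hφ.mul hψ, by simp [h0, h0'], ?_⟩
  filter_upwards [hz, hz', self_mem_nhdsWithin] with z h1 h2 h3
  have h3 : z ≠ 0 := h3
  rw [h1, h2, zpow_add₀ h3]
  ring

theorem add (hg : HasLead g k c) (hh : HasLead h k d) :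
    HasLead (fun z => g z + h z) k (c + d) := by
  obtain ⟨φ, hφ, h0, hz⟩ := hg
  obtain ⟨ψ, hψ, h0', hz'⟩ := hh
  refine ⟨fun z => φ z + ψ z, hφ.add hψ, by simp [h0, h0'], ?_⟩
  filter_upwards [hz, hz'] with z h1 h2
  rw [h1, h2]
  ring

theorem const_mul (hg : HasLead g k c) (a : ℂ) : HasLead (fun z => a * g z) k (a * c) := by
  obtain ⟨φ, hφ, h0, hz⟩ := hg
  refine ⟨fun z => a * φ z, analyticAt_const.mul hφ, by simp [h0], ?_⟩
  filter_upwards [hz] with z h1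
  rw [h1]
  ring

theorem sub (hg : HasLead g k c) (hh : HasLead h k d) :
    HasLead (fun z => g z - h z) k (c - d) := by
  simpa [sub_eq_add_neg] using hg.add (hh.const_mul (-1))

theorem const (a : ℂ) : HasLead (fun _ => a) 0 a :=
  ⟨fun _ => a, analyticAt_const, rfl, by simp⟩

theorem pow (hg : HasLead g k c) (m : ℕ) : HasLead (fun z => g z ^ m) (k * m) (c ^ m) := by
  induction m with
  | zero => simpa using const 1
  | succ m ih =>
    have := ih.mul hg
    simp only [← pow_succ] at this
    convert! this using 1
    push_cast
    ring

/-- The leading coefficient `0` raises the order. -/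
theorem succ (hg : HasLead g k 0) : ∃ d, HasLead g (k + 1) d := by
  obtain ⟨φ, hφ, h0, hz⟩ := hg
  refine ⟨dslope φ 0 0, dslope φ 0, ?_, rfl, ?_⟩
  · obtain ⟨p, hp⟩ := hφ
    exact ⟨_, hp.has_fpower_series_dslope_fslope⟩
  · filter_upwards [hz, self_mem_nhdsWithin] with z h1 h3
    have h3 : z ≠ 0 := h3
    rw [h1, zpow_add_one₀ h3, dslope_of_ne _ h3, slope_def_field, h0]
    field_simp
    simp [mul_comm]

theorem pred (hg : HasLead g k c) : HasLead g (k - 1) 0 := by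
  obtain ⟨φ, hφ, h0, hz⟩ := hg
  refine ⟨fun z => z * φ z, analyticAt_id.mul hφ, by simp, ?_⟩
  filter_upwards [hz, self_mem_nhdsWithin] with z h1 h3
  have h3 : z ≠ 0 := h3
  rw [h1, zpow_sub_one₀ h3]
  field_simp

theorem of_lt (hg : HasLead g l c) (hkl : k < l) : HasLead g k 0 := by
  obtain ⟨n, rfl⟩ : ∃ n : ℕ, l = k + 1 + n := ⟨(l - k - 1).toNat, by omega⟩
  clear hkl
  induction n generalizing c with
  | zero => simpa using hg.pred
  | succ n ih =>
    apply ih (c := 0)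
    convert! hg.pred using 1
    push_cast
    ring

theorem deriv (hg : HasLead g k c) : HasLead (deriv g) (k - 1) (k * c) := by
  obtain ⟨φ, hφ, h0, hz⟩ := hg
  refine ⟨fun z => k * φ z + z * _root_.deriv φ z,
    (analyticAt_const.mul hφ).add (analyticAt_id.mul hφ.deriv), by simp [h0], ?_⟩
  have hφ' : ∀ᶠ z in 𝓝[≠] (0 : ℂ), DifferentiableAt ℂ φ z :=
    (hφ.eventually_analyticAt.filter_mono nhdsWithin_le_nhds).mono fun _ h => h.differentiableAt
  have hz' : g =ᶠ[𝓝[≠] (0 : ℂ)] fun z => z ^ k * φ z := hz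
  filter_upwards [hz'.nhdsNE_deriv, hφ', self_mem_nhdsWithin] with z h1 h2 h3
  have h3 : z ≠ 0 := h3
  rw [h1]
  rw [((hasDerivAt_zpow k z (Or.inl h3)).fun_mul h2.hasDerivAt).deriv, zpow_sub_one₀ h3]
  field_simp

theorem comp_neg (hg : HasLead g k c) : HasLead (fun z => g (-z)) k ((-1) ^ k * c) := by
  obtain ⟨φ, hφ, h0, hz⟩ := hg
  have ht : Tendsto (fun z : ℂ => -z) (𝓝[≠] (0 : ℂ)) (𝓝[≠] (0 : ℂ)) := by
    refine tendsto_nhdsWithin_iff.2 ⟨?_, ?_⟩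
    · exact (continuous_neg.tendsto' 0 0 (by simp)).mono_left nhdsWithin_le_nhds
    · filter_upwards [self_mem_nhdsWithin] with z h3
      simpa using h3
  refine ⟨fun z => (-1) ^ k * φ (-z), analyticAt_const.mul ?_, by simp [h0], ?_⟩
  · have h1 : AnalyticAt ℂ φ (-(0 : ℂ)) := by simpa using hφ
    exact h1.comp analyticAt_id.neg
  · filter_upwards [ht.eventually hz] with z h1
    rw [h1, neg_eq_neg_one_mul z, mul_zpow]
    ring

end HasLead

/-! ### The lattice, elliptic functions and the basis $\mathcal E_m$ -/

theorem isOpen_compl_latticeSet (τ : UpperHalfPlane) : IsOpen (latticeSet τ)ᶜ :=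
  (periods τ).isClosed_lattice.isOpen_compl

theorem mem_latticeSet {τ : UpperHalfPlane} {z : ℂ} :
    z ∈ latticeSet τ ↔ ∃ m n : ℤ, (m : ℂ) + n * (τ : ℂ) = z := by
  simp [latticeSet, PeriodPair.mem_lattice, periods]

theorem eventually_notMem_latticeSet (τ : UpperHalfPlane) (x : ℂ) :
    ∀ᶠ z in 𝓝[≠] x, z ∉ latticeSet τ := by
  have := (periods τ).compl_lattice_sdiff_singleton_mem_nhds x
  rw [eventually_nhdsWithin_iff]
  filter_upwards [this] with z hz hne hmem
  exact hz ⟨hmem, hne⟩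

theorem eventually_differentiableAt {τ : UpperHalfPlane} {g : ℂ → ℂ}
    (hg : DifferentiableOn ℂ g (latticeSet τ)ᶜ) (x : ℂ) :
    ∀ᶠ z in 𝓝[≠] x, DifferentiableAt ℂ g z :=
  (eventually_notMem_latticeSet τ x).mono fun _ hz =>
    hg.differentiableAt ((isOpen_compl_latticeSet τ).mem_nhds hz)

theorem add_int_mem_latticeSet {τ : UpperHalfPlane} {z : ℂ} (m n : ℤ) :
    z + (m + n * (τ : ℂ)) ∈ latticeSet τ ↔ z ∈ latticeSet τ :=
  (periods τ).lattice.add_mem_iff_left (mem_latticeSet.2 ⟨m, n, rfl⟩)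

theorem add_one_mem_latticeSet {τ : UpperHalfPlane} {z : ℂ} :
    z + 1 ∈ latticeSet τ ↔ z ∈ latticeSet τ := by
  simpa using add_int_mem_latticeSet (τ := τ) (z := z) 1 0

theorem add_tau_mem_latticeSet {τ : UpperHalfPlane} {z : ℂ} :
    z + (τ : ℂ) ∈ latticeSet τ ↔ z ∈ latticeSet τ := by
  simpa using add_int_mem_latticeSet (τ := τ) (z := z) 0 1

theorem neg_mem_latticeSet {τ : UpperHalfPlane} {z : ℂ} :
    -z ∈ latticeSet τ ↔ z ∈ latticeSet τ :=
  (periods τ).lattice.neg_mem_iff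

/-- Elliptic functions with periods `1` and `τ` and with poles in the lattice only. -/
structure IsElliptic (τ : UpperHalfPlane) (g : ℂ → ℂ) : Prop where
  differentiableOn : DifferentiableOn ℂ g (latticeSet τ)ᶜ
  add_one : ∀ z ∉ latticeSet τ, g (z + 1) = g z
  add_tau : ∀ z ∉ latticeSet τ, g (z + (τ : ℂ)) = g z

namespace IsElliptic

variable {τ : UpperHalfPlane} {g h : ℂ → ℂ}

theorem const (c : ℂ) : IsElliptic τ (fun _ => c) :=
  ⟨differentiableOn_const c, fun _ _ => rfl, fun _ _ => rfl⟩

theorem add (hg : IsElliptic τ g) (hh : IsElliptic τ h) : IsElliptic τ (fun z => g z + h z) :=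
  ⟨hg.1.add hh.1, fun z hz => by rw [hg.2 z hz, hh.2 z hz],
    fun z hz => by rw [hg.3 z hz, hh.3 z hz]⟩

theorem mul (hg : IsElliptic τ g) (hh : IsElliptic τ h) : IsElliptic τ (fun z => g z * h z) :=
  ⟨hg.1.mul hh.1, fun z hz => by rw [hg.2 z hz, hh.2 z hz],
    fun z hz => by rw [hg.3 z hz, hh.3 z hz]⟩

theorem const_mul (hg : IsElliptic τ g) (c : ℂ) : IsElliptic τ (fun z => c * g z) :=
  (const c).mul hg

theorem sub (hg : IsElliptic τ g) (hh : IsElliptic τ h) : IsElliptic τ (fun z => g z - h z) := by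
  simpa [sub_eq_add_neg] using hg.add (hh.const_mul (-1))

theorem pow (hg : IsElliptic τ g) (m : ℕ) : IsElliptic τ (fun z => g z ^ m) :=
  ⟨hg.1.pow m, fun z hz => by rw [hg.2 z hz], fun z hz => by rw [hg.3 z hz]⟩

theorem comp_neg (hg : IsElliptic τ g) : IsElliptic τ (fun z => g (-z)) := by
  refine ⟨?_, fun z hz => ?_, fun z hz => ?_⟩
  · exact hg.1.comp differentiable_neg.differentiableOn fun z hz =>
      fun h => hz (neg_mem_latticeSet.1 h)
  · have h1 : -(z + 1) ∉ latticeSet τ := by rwa [neg_mem_latticeSet, add_one_mem_latticeSet]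
    rw [← hg.2 _ h1]
    ring_nf
  · have h1 : -(z + (τ : ℂ)) ∉ latticeSet τ := by rwa [neg_mem_latticeSet, add_tau_mem_latticeSet]
    rw [← hg.3 _ h1]
    ring_nf

theorem differentiableAt (hg : IsElliptic τ g) {z : ℂ} (hz : z ∉ latticeSet τ) :
    DifferentiableAt ℂ g z :=
  hg.1.differentiableAt ((isOpen_compl_latticeSet τ).mem_nhds hz)

end IsElliptic

/-- The derivative of a relation `g (z + w) = h z` off the lattice. -/
theorem deriv_add_eq {τ : UpperHalfPlane} {g h : ℂ → ℂ} {w : ℂ}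
    (H : ∀ z ∉ latticeSet τ, g (z + w) = h z) {z : ℂ} (hz : z ∉ latticeSet τ) :
    deriv g (z + w) = deriv h z := by
  rw [← deriv_comp_add_const]
  apply Filter.EventuallyEq.deriv_eq
  filter_upwards [(isOpen_compl_latticeSet τ).mem_nhds hz] with u hu using H u hu

theorem IsElliptic.deriv {τ : UpperHalfPlane} {g : ℂ → ℂ} (hg : IsElliptic τ g) :
    IsElliptic τ (deriv g) :=
  ⟨hg.1.deriv (isOpen_compl_latticeSet τ), fun _ hz => deriv_add_eq hg.2 hz,
    fun _ hz => deriv_add_eq hg.3 hz⟩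

theorem isElliptic_wp (τ : UpperHalfPlane) : IsElliptic τ (wp τ) := by
  refine ⟨(periods τ).differentiableOn_weierstrassP, fun z _ => ?_, fun z _ => ?_⟩
  · exact (periods τ).weierstrassP_add_coe z ⟨_, (periods τ).ω₁_mem_lattice⟩
  · exact (periods τ).weierstrassP_add_coe z ⟨_, (periods τ).ω₂_mem_lattice⟩

theorem deriv_wp (τ : UpperHalfPlane) : deriv (wp τ) = wp' τ :=
  (periods τ).deriv_weierstrassP

theorem isElliptic_wp' (τ : UpperHalfPlane) : IsElliptic τ (wp' τ) :=
  deriv_wp τ ▸ (isElliptic_wp τ).deriv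

theorem hasLead_wp (τ : UpperHalfPlane) : HasLead (wp τ) (-2) 1 := by
  refine ⟨fun z => 1 + z ^ 2 * (periods τ).weierstrassPExcept 0 z, ?_, by simp, ?_⟩
  · exact analyticAt_const.add
      ((analyticAt_id.pow 2).mul ((periods τ).analyticAt_weierstrassPExcept 0))
  · filter_upwards [self_mem_nhdsWithin] with z h3
    have h3 : z ≠ 0 := h3
    have h4 := (periods τ).weierstrassPExcept_add 0 z
    simp only [ZeroMemClass.coe_zero, sub_zero] at h4
    rw [wp, ← h4, zpow_neg, zpow_ofNat]
    field_simp
    simp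
    ring

theorem hasLead_wp' (τ : UpperHalfPlane) : HasLead (wp' τ) (-3) (-2) := by
  have := (hasLead_wp τ).deriv
  rw [deriv_wp] at this
  convert! this using 1
  norm_num

theorem isElliptic_ellBasis (τ : UpperHalfPlane) (m : ℕ) : IsElliptic τ (ellBasis τ m) := by
  unfold ellBasis
  split_ifs
  · exact (isElliptic_wp τ).pow _
  · exact ((isElliptic_wp' τ).const_mul _).mul ((isElliptic_wp τ).pow _)

theorem hasLead_ellBasis (τ : UpperHalfPlane) {m : ℕ} (hm : m ≠ 1) :
    HasLead (ellBasis τ m) (-m) 1 := by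
  unfold ellBasis
  split_ifs with h
  · obtain ⟨k, rfl⟩ := h
    convert! (hasLead_wp τ).pow ((k + k) / 2) using 1
    · omega
    · simp
  · rw [Nat.not_even_iff_odd] at h
    obtain ⟨k, rfl⟩ := h
    convert! ((hasLead_wp' τ).const_mul (-(1 / 2))).mul
      ((hasLead_wp τ).pow ((2 * k + 1 - 3) / 2)) using 1
    · omega
    · norm_num

/-! ### The residue theorem on a period strip -/

section Residue

/-- The `1`-periodic function `2πi e²ᵖⁱᶻ / (e²ᵖⁱᶻ - 1)`, with simple poles of residue `1` at the
integers. -/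
noncomputable def cotKernel (z : ℂ) : ℂ :=
  2 * Real.pi * Complex.I * Complex.exp (2 * Real.pi * Complex.I * z) /
    (Complex.exp (2 * Real.pi * Complex.I * z) - 1)

theorem cotKernel_add_one (z : ℂ) : cotKernel (z + 1) = cotKernel z := by
  simp only [cotKernel, mul_add, mul_one, Complex.exp_add, Complex.exp_two_pi_mul_I]

theorem exp_sub_one_ne_zero {z : ℂ} (hz : ∀ m : ℤ, z ≠ m) :
    Complex.exp (2 * Real.pi * Complex.I * z) - 1 ≠ 0 := by
  intro h
  obtain ⟨n, hn⟩ := Complex.exp_eq_one_iff.1 (sub_eq_zero.1 h)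
  apply hz n
  have h2 : (2 * Real.pi * Complex.I : ℂ) ≠ 0 := Complex.two_pi_I_ne_zero
  apply mul_left_cancel₀ h2
  rw [hn]
  ring

theorem differentiableAt_cotKernel {z : ℂ} (hz : ∀ m : ℤ, z ≠ m) :
    DifferentiableAt ℂ cotKernel z := by
  unfold cotKernel
  exact DifferentiableAt.div (by fun_prop) (by fun_prop) (exp_sub_one_ne_zero hz)

theorem hasLead_cotKernel : HasLead cotKernel (-1) 1 := by
  have h2 : (2 * Real.pi * Complex.I : ℂ) ≠ 0 := Complex.two_pi_I_ne_zero
  have hd : HasDerivAt (fun z : ℂ => Complex.exp (2 * Real.pi * Complex.I * z))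
      (2 * Real.pi * Complex.I) 0 := by
    simpa using ((hasDerivAt_id (0 : ℂ)).const_mul (2 * Real.pi * Complex.I : ℂ)).cexp
  have hs := hd.tendsto_slope
  have he : Tendsto (fun z : ℂ => 2 * Real.pi * Complex.I *
      Complex.exp (2 * Real.pi * Complex.I * z)) (𝓝[≠] (0 : ℂ)) (𝓝 (2 * Real.pi * Complex.I)) := by
    have : Continuous (fun z : ℂ => 2 * Real.pi * Complex.I *
      Complex.exp (2 * Real.pi * Complex.I * z)) := by fun_prop
    exact (this.tendsto' 0 _ (by simp)).mono_left nhdsWithin_le_nhds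
  have hne : ∀ᶠ z : ℂ in 𝓝[≠] (0 : ℂ), ∀ m : ℤ, z ≠ (m : ℂ) := by
    have h1 : ∀ᶠ z in 𝓝 (0 : ℂ), z ∈ Metric.ball (0 : ℂ) 1 := Metric.ball_mem_nhds 0 one_pos
    filter_upwards [h1.filter_mono nhdsWithin_le_nhds, self_mem_nhdsWithin] with z h1 h3 m hm
    have h3 : z ≠ 0 := h3
    subst hm
    rw [mem_ball_zero_iff, Complex.norm_intCast] at h1
    have h4 : |m| < 1 := by exact_mod_cast h1
    apply h3
    rw [Int.abs_lt_one_iff.1 h4]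
    simp
  refine HasLead.of_tendsto (hne.mono fun z hz => differentiableAt_cotKernel hz) ?_
  have := he.div hs h2
  rw [div_self h2] at this
  refine this.congr' ?_
  filter_upwards [self_mem_nhdsWithin, hne] with z h3 h4
  have h3 : z ≠ 0 := h3
  have := exp_sub_one_ne_zero h4
  simp only [Pi.div_apply, slope_def_field, cotKernel, mul_zero, Complex.exp_zero, sub_zero,
    neg_neg, zpow_one]
  field_simp

/-- With $w=e^{2\pi iz}$ the segment becomes a circle of radius $e^{-2\pi y}<1$ about $0$, inside
which $2\pi iw/(w-1)$ is holomorphic with value $0$ at the centre. The mean value property gives the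
integral. -/
theorem integral_cotKernel_of_pos {y : ℝ} (hy : 0 < y) :
    ∫ x in (0 : ℝ)..1, cotKernel (x + y * Complex.I) = 0 := by
  set R : ℝ := Real.exp (-(2 * Real.pi * y)) with hR
  have hR1 : R < 1 := by
    rw [hR, Real.exp_lt_one_iff]
    have := Real.pi_pos
    have : 0 < 2 * Real.pi * y := by positivity
    linarith
  have hR0 : 0 < R := Real.exp_pos _
  let H : ℂ → ℂ := fun w => 2 * Real.pi * Complex.I * w / (w - 1)
  have hH : DiffContOnCl ℂ H (Metric.ball 0 |R|) := by
    apply DifferentiableOn.diffContOnCl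
    intro w hw
    have h1 : w ∈ Metric.closedBall (0 : ℂ) |R| := Metric.closure_ball_subset_closedBall hw
    rw [mem_closedBall_zero_iff, abs_of_pos hR0] at h1
    have h2 : w - 1 ≠ 0 := by
      intro h
      rw [sub_eq_zero.1 h, norm_one] at h1
      linarith
    apply DifferentiableAt.differentiableWithinAt
    exact DifferentiableAt.div (by fun_prop) (by fun_prop) h2
  have h1 := hH.circleAverage
  have h0 : H 0 = 0 := by simp [H]
  rw [h0, Real.circleAverage_def] at h1
  have h2 : ∀ x : ℝ, cotKernel (x + y * Complex.I) = H (circleMap 0 R (2 * Real.pi * x)) := by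
    intro x
    have : Complex.exp (2 * Real.pi * Complex.I * (x + y * Complex.I)) =
        circleMap 0 R (2 * Real.pi * x) := by
      rw [circleMap, hR, zero_add, Complex.ofReal_exp, ← Complex.exp_add]
      congr 1
      push_cast
      linear_combination (2 * Real.pi * y : ℂ) * Complex.I_mul_I
    simp only [cotKernel, H, this]
  simp_rw [h2]
  have hpi : (2 * Real.pi : ℝ) ≠ 0 := by positivity
  rw [intervalIntegral.integral_comp_mul_left (fun θ => H (circleMap 0 R θ)) hpi]
  simpa using h1

theorem cotKernel_eq_sub_neg {z : ℂ} (hz : ∀ m : ℤ, z ≠ m) :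
    cotKernel z = 2 * Real.pi * Complex.I - cotKernel (-z) := by
  have h1 := exp_sub_one_ne_zero hz
  have h2 : ∀ m : ℤ, -z ≠ m := fun m hm => hz (-m) (by push_cast; rw [← hm, neg_neg])
  have h3 := exp_sub_one_ne_zero h2
  simp only [cotKernel, mul_neg, Complex.exp_neg] at h3 ⊢
  have h4 := Complex.exp_ne_zero (2 * Real.pi * Complex.I * z)
  set e := Complex.exp (2 * Real.pi * Complex.I * z)
  have h5 : 1 - e ≠ 0 := by
    intro h
    apply h1
    linear_combination -h
  have h6 : e⁻¹ / (e⁻¹ - 1) = 1 / (1 - e) := by field_simp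
  rw [mul_div_assoc, mul_div_assoc, h6]
  field_simp
  ring

theorem integral_cotKernel_of_neg {y : ℝ} (hy : 0 < y) :
    ∫ x in (0 : ℝ)..1, cotKernel (x - y * Complex.I) = 2 * Real.pi * Complex.I := by
  have hne : ∀ x : ℝ, ∀ m : ℤ, (x - y * Complex.I : ℂ) ≠ m := by
    intro x m h
    have := congrArg Complex.im h
    simp at this
    linarith
  have h1 : ∀ x : ℝ, cotKernel (x - y * Complex.I) =
      2 * Real.pi * Complex.I - cotKernel ((1 - x : ℝ) + y * Complex.I) := by
    intro x
    rw [cotKernel_eq_sub_neg (hne x), ← cotKernel_add_one]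
    congr 2
    push_cast
    ring
  simp_rw [h1]
  have hc : Continuous fun x : ℝ => cotKernel (x + y * Complex.I) := by
    rw [continuous_iff_continuousAt]
    intro x
    have h2 : ∀ m : ℤ, (x + y * Complex.I : ℂ) ≠ m := by
      intro m h
      have := congrArg Complex.im h
      simp at this
      linarith
    exact ContinuousAt.comp' (differentiableAt_cotKernel h2).continuousAt (by fun_prop)
  have hc' : Continuous fun x : ℝ => cotKernel ((1 - x : ℝ) + y * Complex.I) :=
    hc.comp (continuous_const.sub continuous_id)
  rw [intervalIntegral.integral_sub (by simp) (hc'.intervalIntegrable _ _),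
    intervalIntegral.integral_comp_sub_left (fun x : ℝ => cotKernel (x + y * Complex.I)) 1]
  simp [integral_cotKernel_of_pos hy]

/-- The extension of `g` to the lattice by a constant. -/
noncomputable def fillLattice (τ : UpperHalfPlane) (c : ℂ) (g : ℂ → ℂ) (z : ℂ) : ℂ :=
  open Classical in if z ∈ latticeSet τ then c else g z

variable {τ : UpperHalfPlane} {g : ℂ → ℂ} {c : ℂ}

theorem fillLattice_of_notMem {z : ℂ} (hz : z ∉ latticeSet τ) : fillLattice τ c g z = g z :=
  if_neg hz

theorem fillLattice_add {w : ℂ} (hw : ∀ z, z + w ∈ latticeSet τ ↔ z ∈ latticeSet τ)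
    (h : ∀ z ∉ latticeSet τ, g (z + w) = g z) (z : ℂ) :
    fillLattice τ c g (z + w) = fillLattice τ c g z := by
  unfold fillLattice
  by_cases hz : z ∈ latticeSet τ
  · rw [if_pos hz, if_pos ((hw z).2 hz)]
  · rw [if_neg hz, if_neg (fun h => hz ((hw z).1 h)), h z hz]

theorem zero_mem_latticeSet (τ : UpperHalfPlane) : (0 : ℂ) ∈ latticeSet τ :=
  (periods τ).lattice.zero_mem

/-- Invariance is required only under translation by the point $w$ itself, so the lemma serves both
1-periodic functions near the real axis and fully elliptic functions. -/
theorem differentiableAt_fillLattice (hd : DifferentiableOn ℂ g (latticeSet τ)ᶜ)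
    (hl : HasLead g 0 c) {w : ℂ} (hw : w ∈ latticeSet τ → ∀ z ∉ latticeSet τ, g (z + w) = g z) :
    DifferentiableAt ℂ (fillLattice τ c g) w := by
  by_cases hmem : w ∈ latticeSet τ
  · obtain ⟨φ, hφ, h0, hz⟩ := hl
    have h1 : ∀ᶠ z in 𝓝 (0 : ℂ), fillLattice τ c g z = φ z := by
      have := hz.and (eventually_notMem_latticeSet τ 0)
      rw [eventually_nhdsWithin_iff] at this
      filter_upwards [this] with z hz
      by_cases h : z = 0
      · subst h
        rw [fillLattice, if_pos (zero_mem_latticeSet τ), h0]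
      · obtain ⟨h2, h3⟩ := hz h
        rw [fillLattice_of_notMem h3, h2]
        simp
    have h2 : Tendsto (fun z : ℂ => z - w) (𝓝 w) (𝓝 0) :=
      (continuous_id.sub continuous_const).tendsto' w 0 (by simp)
    have hφ' : DifferentiableAt ℂ φ (w - w) := by
      rw [sub_self]; exact hφ.differentiableAt
    have h3 : DifferentiableAt ℂ (fun z => φ (z - w)) w :=
      DifferentiableAt.comp (g := φ) (f := fun z => z - w) w hφ' (differentiableAt_id.sub_const w)
    refine h3.congr_of_eventuallyEq ?_
    filter_upwards [h2.eventually h1] with z hz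
    rw [← hz, ← fillLattice_add (w := w) (fun u => (periods τ).lattice.add_mem_iff_left hmem)
      (hw hmem) (z - w), sub_add_cancel]
  · refine (hd.differentiableAt ((isOpen_compl_latticeSet τ).mem_nhds hmem)).congr_of_eventuallyEq ?_
    filter_upwards [(isOpen_compl_latticeSet τ).mem_nhds hmem] with z hz using
      fillLattice_of_notMem hz

theorem add_intCast_mul_eq {S : Set ℂ} {w : ℂ} (hS : ∀ z, z + w ∈ S ↔ z ∈ S)
    (h : ∀ z ∈ S, g (z + w) = g z) (n : ℤ) : ∀ z ∈ S, z + n * w ∈ S ∧ g (z + n * w) = g z := by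
  induction n with
  | zero => simp
  | succ i ih =>
    intro z hz
    obtain ⟨h1, h2⟩ := ih z hz
    have e : z + ((i : ℤ) + 1 : ℤ) * w = z + (i : ℤ) * w + w := by push_cast; ring
    exact ⟨e ▸ (hS _).2 h1, by rw [e, h _ h1, h2]⟩
  | pred i ih =>
    intro z hz
    obtain ⟨h1, h2⟩ := ih z hz
    have e : z + (-(i : ℤ) : ℤ) * w = z + (-(i : ℤ) - 1 : ℤ) * w + w := by push_cast; ring
    rw [e] at h1
    have h3 := (hS _).1 h1
    exact ⟨h3, by rw [← h2, e, h _ h3]⟩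

theorem eq_intCast_of_mem_latticeSet {z : ℂ} (hz : z ∈ latticeSet τ) (him : |z.im| < τ.im) :
    ∃ m : ℤ, z = m := by
  obtain ⟨m, n, rfl⟩ := mem_latticeSet.1 hz
  have h1 : ((m : ℂ) + n * (τ : ℂ)).im = n * τ.im := by simp
  rw [h1, abs_mul, abs_of_pos τ.im_pos] at him
  have h2 : |(n : ℝ)| < 1 := by
    have := τ.im_pos
    nlinarith
  have h3 : n = 0 := Int.abs_lt_one_iff.1 (by exact_mod_cast h2)
  exact ⟨m, by simp [h3]⟩

theorem notMem_latticeSet_of_im {z : ℂ} (h0 : z.im ≠ 0) (him : |z.im| < τ.im) :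
    z ∉ latticeSet τ := by
  intro hz
  obtain ⟨m, rfl⟩ := eq_intCast_of_mem_latticeSet hz him
  simp at h0

/-- Cauchy's theorem on a period strip for a function with removable singularities. -/
theorem integral_strip_eq_of_hasLead_zero (hd : DifferentiableOn ℂ g (latticeSet τ)ᶜ)
    (h1 : ∀ z ∉ latticeSet τ, g (z + 1) = g z) (hl : HasLead g 0 c) {y : ℝ} (hy : 0 < y)
    (hy' : y < τ.im) :
    ∫ x in (0 : ℝ)..1, g (x - y * Complex.I) = ∫ x in (0 : ℝ)..1, g (x + y * Complex.I) := by
  have hdG : ∀ z : ℂ, |z.im| < τ.im → DifferentiableAt ℂ (fillLattice τ c g) z := by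
    intro z hz
    refine differentiableAt_fillLattice hd hl fun hmem => ?_
    obtain ⟨m, rfl⟩ := eq_intCast_of_mem_latticeSet hmem hz
    intro u hu
    simpa using (add_intCast_mul_eq (S := (latticeSet τ)ᶜ)
      (fun _ => not_congr add_one_mem_latticeSet) h1 m u hu).2
  have hrect := Complex.integral_boundary_rect_eq_zero_of_differentiableOn (fillLattice τ c g)
    (-(y * Complex.I)) (1 + y * Complex.I) (by
      intro z hz
      refine (hdG z ?_).differentiableWithinAt
      have h2 := hz.2
      simp only [Set.mem_preimage, Complex.neg_im, Complex.add_im, Complex.one_im, Complex.mul_im,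
        Complex.ofReal_re, Complex.I_im, Complex.ofReal_im, Complex.I_re, mul_one, mul_zero,
        add_zero, zero_add] at h2
      rw [Set.uIcc_of_le (by linarith)] at h2
      exact (abs_le.2 h2).trans_lt hy')
  simp only [Complex.neg_re, Complex.neg_im, Complex.add_im, Complex.add_re, Complex.one_re,
    Complex.one_im, Complex.mul_im, Complex.mul_re, Complex.ofReal_re, Complex.I_im,
    Complex.ofReal_im, Complex.I_re, mul_one, mul_zero, add_zero, zero_add, neg_zero,
    Complex.ofReal_neg, Complex.ofReal_one, Complex.ofReal_zero, sub_self] at hrect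
  -- By 1-periodicity the two vertical sides of the rectangle cancel.
  have hper : ∀ u : ℝ, fillLattice τ c g (1 + u * Complex.I) =
      fillLattice τ c g (u * Complex.I) := by
    intro u
    rw [add_comm, fillLattice_add (fun _ => add_one_mem_latticeSet) h1]
  simp only [hper, add_sub_cancel_right] at hrect
  have hm : ∀ x : ℝ, (x : ℂ) - y * Complex.I ∉ latticeSet τ := fun x =>
    notMem_latticeSet_of_im (by simp [hy.ne']) (by simpa [abs_of_pos hy] using hy')
  have hp : ∀ x : ℝ, (x : ℂ) + y * Complex.I ∉ latticeSet τ := fun x =>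
    notMem_latticeSet_of_im (by simp [hy.ne']) (by simpa [abs_of_pos hy] using hy')
  simp only [neg_mul, ← sub_eq_add_neg, fillLattice_of_notMem (hm _),
    fillLattice_of_notMem (hp _)] at hrect
  exact sub_eq_zero.1 hrect

theorem continuous_horizontal (hd : DifferentiableOn ℂ g (latticeSet τ)ᶜ) {w : ℂ}
    (hw : ∀ t : ℝ, w + t ∉ latticeSet τ) : Continuous fun t : ℝ => g (w + t) := by
  rw [continuous_iff_continuousAt]
  intro t
  have h1 : DifferentiableAt ℂ g (w + t) :=
    hd.differentiableAt ((isOpen_compl_latticeSet τ).mem_nhds (hw t))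
  exact ContinuousAt.comp' h1.continuousAt (by fun_prop)

theorem integral_horizontal_shift (h1 : ∀ z ∉ latticeSet τ, g (z + 1) = g z) {w : ℂ}
    (hw : ∀ t : ℝ, w + t ∉ latticeSet τ) (s : ℝ) :
    ∫ t in (0 : ℝ)..1, g (w + s + t) = ∫ t in (0 : ℝ)..1, g (w + t) := by
  have hp : Function.Periodic (fun t : ℝ => g (w + t)) 1 := by
    intro t
    simp only
    rw [← h1 _ (hw t)]
    push_cast
    ring_nf
  have h2 := hp.intervalIntegral_add_eq s 0
  rw [zero_add] at h2
  have h3 := intervalIntegral.integral_comp_add_left (fun t : ℝ => g (w + t)) s (a := 0) (b := 1)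
  rw [add_zero] at h3
  rw [← h2, ← h3]
  congr 1
  ext t
  push_cast
  ring_nf

theorem half_tau_add_notMem (τ : UpperHalfPlane) (t : ℝ) : (τ : ℂ) / 2 + t ∉ latticeSet τ := by
  have := τ.im_pos
  refine notMem_latticeSet_of_im ?_ ?_
  · simp [τ.im_ne_zero]
  · simp only [Complex.add_im, Complex.div_ofNat_im, UpperHalfPlane.coe_im, Complex.ofReal_im,
      add_zero]
    rw [abs_of_pos (by linarith)]
    linarith

/-- The residue theorem on a period strip for a function with at most simple poles. -/
theorem gammaIntegral_sub_eq_residue (hd : DifferentiableOn ℂ g (latticeSet τ)ᶜ)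
    (h1 : ∀ z ∉ latticeSet τ, g (z + 1) = g z) (hl : HasLead g (-1) c) :
    gammaIntegral τ (fun z => g (z - τ)) - gammaIntegral τ g = 2 * Real.pi * Complex.I * c := by
  have hτ := τ.im_pos
  set y : ℝ := τ.im / 2 with hy
  have hy0 : 0 < y := by positivity
  have hm : ∀ x : ℝ, -(y * Complex.I) + (x : ℂ) ∉ latticeSet τ := fun x =>
    notMem_latticeSet_of_im (by simp [hy0.ne']) (by simp [abs_of_pos hy0]; linarith)
  have hp : ∀ x : ℝ, y * Complex.I + (x : ℂ) ∉ latticeSet τ := fun x =>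
    notMem_latticeSet_of_im (by simp [hy0.ne']) (by simp [abs_of_pos hy0]; linarith)
  -- The segments at $\pm\tau/2$ are slid horizontally onto the sides of the symmetric rectangle;
  -- 1-periodicity keeps the integrals unchanged.
  have e1 : (τ : ℂ) / 2 = y * Complex.I + (τ.re / 2 : ℝ) := by
    apply Complex.ext <;> simp [hy]
  have e2 : (τ : ℂ) / 2 - τ = -(y * Complex.I) + (-(τ.re / 2) : ℝ) := by
    rw [show (τ : ℂ) / 2 - τ = -((τ : ℂ) / 2) by ring, e1]
    push_cast
    ring
  have i1 : gammaIntegral τ g = ∫ x in (0 : ℝ)..1, g (y * Complex.I + x) := by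
    rw [gammaIntegral, e1, integral_horizontal_shift h1 hp]
  have i2 : gammaIntegral τ (fun z => g (z - τ)) =
      ∫ x in (0 : ℝ)..1, g (-(y * Complex.I) + x) := by
    rw [gammaIntegral, ← integral_horizontal_shift h1 hm, ← e2]
    congr 1
    ext t
    ring_nf
  have hint : ∀ {z : ℂ}, z ∉ latticeSet τ → ∀ m : ℤ, z ≠ m := by
    rintro z hz m rfl
    exact hz (mem_latticeSet.2 ⟨m, 0, by simp⟩)
  have hdc : DifferentiableOn ℂ cotKernel (latticeSet τ)ᶜ := fun z hz =>
    (differentiableAt_cotKernel (hint hz)).differentiableWithinAt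
  -- Subtracting $c$ times the kernel removes the poles at all integers, the only lattice points in
  -- the strip. The kernel integrates to $2\pi i$ below the real axis and to $0$ above it.
  have hl0 : HasLead (fun z => g z - c * cotKernel z) (-1) 0 := by
    simpa using hl.sub (hasLead_cotKernel.const_mul c)
  obtain ⟨e, he⟩ := hl0.succ
  have hs := integral_strip_eq_of_hasLead_zero (g := fun z => g z - c * cotKernel z)
    (hd.sub (hdc.const_mul c)) (fun z hz => by rw [h1 z hz, cotKernel_add_one]) he hy0 (by linarith)
  have r1 : ∀ x : ℝ, (x : ℂ) - y * Complex.I = -(y * Complex.I) + x := fun x => by ring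
  have r2 : ∀ x : ℝ, (x : ℂ) + y * Complex.I = y * Complex.I + x := fun x => by ring
  have k1 := integral_cotKernel_of_neg hy0
  have k2 := integral_cotKernel_of_pos hy0
  simp only [r1, r2] at hs k1 k2
  rw [intervalIntegral.integral_sub, intervalIntegral.integral_sub,
    intervalIntegral.integral_const_mul, intervalIntegral.integral_const_mul, k1, k2] at hs
  · rw [i1, i2]
    linear_combination hs
  · exact (continuous_horizontal hd hp).intervalIntegrable _ _
  · exact ((continuous_horizontal hdc hp).const_mul c).intervalIntegrable _ _
  · exact (continuous_horizontal hd hm).intervalIntegrable _ _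
  · exact ((continuous_horizontal hdc hm).const_mul c).intervalIntegrable _ _

end Residue

/-! ### Liouville's theorem and the basis of elliptic polynomials -/

namespace IsElliptic

variable {τ : UpperHalfPlane} {g : ℂ → ℂ} {c : ℂ}

theorem add_lattice (hg : IsElliptic τ g) {w : ℂ} (hw : w ∈ latticeSet τ) :
    ∀ z ∉ latticeSet τ, g (z + w) = g z := by
  obtain ⟨m, n, rfl⟩ := mem_latticeSet.1 hw
  intro z hz
  obtain ⟨h1, h2⟩ := add_intCast_mul_eq (S := (latticeSet τ)ᶜ)
    (fun _ => not_congr add_tau_mem_latticeSet) hg.add_tau n z hz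
  have h3 := (add_intCast_mul_eq (S := (latticeSet τ)ᶜ)
    (fun _ => not_congr add_one_mem_latticeSet) hg.add_one m _ h1).2
  rw [← h2, ← h3]
  ring_nf

/-- Liouville's theorem for elliptic functions. -/
theorem eq_const_of_hasLead_zero (hg : IsElliptic τ g) (hl : HasLead g 0 c) :
    ∀ z ∉ latticeSet τ, g z = c := by
  have hd : Differentiable ℂ (fillLattice τ c g) := fun w =>
    differentiableAt_fillLattice hg.1 hl fun hw => hg.add_lattice hw
  have hb := IsZLattice.isCompact_range_of_periodic (periods τ).lattice _ hd.continuous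
    fun z w hw => fillLattice_add (c := c) (g := g)
      (fun u => (periods τ).lattice.add_mem_iff_left hw) (hg.add_lattice hw) z
  intro z hz
  have := hd.apply_eq_apply_of_bounded hb.isBounded z 0
  rwa [fillLattice_of_notMem hz, fillLattice, if_pos (zero_mem_latticeSet τ)] at this

/-- By $\tau$-periodicity the integrals over the two sides of the strip are equal. -/
theorem residue_eq_zero (hg : IsElliptic τ g) (hl : HasLead g (-1) c) : c = 0 := by
  have h := gammaIntegral_sub_eq_residue hg.1 hg.2 hl
  have h1 : gammaIntegral τ (fun z => g (z - τ)) = gammaIntegral τ g := by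
    unfold gammaIntegral
    congr 1
    ext t
    have h2 : (τ : ℂ) / 2 + t - τ ∉ latticeSet τ := by
      rw [← add_tau_mem_latticeSet, sub_add_cancel]
      exact half_tau_add_notMem τ t
    simpa using (hg.3 _ h2).symm
  rw [h1, sub_self] at h
  exact (mul_eq_zero.1 h.symm).resolve_left Complex.two_pi_I_ne_zero

theorem eq_const_of_hasLead_neg_one (hg : IsElliptic τ g) (hl : HasLead g (-1) c) :
    ∃ d, ∀ z ∉ latticeSet τ, g z = d := by
  rw [hg.residue_eq_zero hl] at hl
  obtain ⟨d, hd⟩ := hl.succ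
  exact ⟨d, hg.eq_const_of_hasLead_zero hd⟩

/-- Every elliptic polynomial of degree at most `m` is a combination of basis functions. -/
theorem exists_eq_sum (m : ℕ) (hm : 1 ≤ m) :
    ∀ {g : ℂ → ℂ} {c : ℂ}, IsElliptic τ g → HasLead g (-m) c →
      ∃ v : ℕ → ℂ, ∀ z ∉ latticeSet τ, g z = ∑ i ∈ Finset.range m, v i * ellBasis τ (idx i) z := by
  induction m, hm using Nat.le_induction with
  | base =>
    intro g c hg hl
    obtain ⟨d, hd⟩ := hg.eq_const_of_hasLead_neg_one (by simpa using hl)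
    exact ⟨fun _ => d, fun z hz => by simp [hd z hz, idx, ellBasis]⟩
  | succ m hm ih =>
    intro g c hg hl
    have h1 := hl.sub ((hasLead_ellBasis τ (m := m + 1) (by omega)).const_mul c)
    rw [mul_one, sub_self] at h1
    obtain ⟨d, hd⟩ := h1.succ
    obtain ⟨v, hv⟩ := ih (hg.sub ((isElliptic_ellBasis τ (m + 1)).const_mul c))
      (by convert! hd using 1; push_cast; ring)
    refine ⟨Function.update v m c, fun z hz => ?_⟩
    -- Position `m` carries the index `m + 1`, since index `1` is skipped; its basis function
    -- removes the leading pole.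
    rw [Finset.sum_range_succ, Function.update_self, idx, if_neg (by omega)]
    rw [sub_eq_iff_eq_add.1 (hv z hz)]
    congr 1
    apply Finset.sum_congr rfl
    intro i hi
    rw [Function.update_of_ne (Finset.mem_range.1 hi).ne]

end IsElliptic

/-! ### Integrals over $\gamma$ and the moment determinant -/

section Integrals

variable {τ : UpperHalfPlane} {g h : ℂ → ℂ}

theorem gammaIntegral_congr (H : ∀ z ∉ latticeSet τ, g z = h z) :
    gammaIntegral τ g = gammaIntegral τ h := by
  unfold gammaIntegral
  congr 1
  ext t
  exact H _ (half_tau_add_notMem τ t)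

theorem continuous_gamma (hg : DifferentiableOn ℂ g (latticeSet τ)ᶜ) :
    Continuous fun t : ℝ => g ((τ : ℂ) / 2 + t) :=
  continuous_horizontal hg (half_tau_add_notMem τ)

theorem gammaIntegral_sub (hg : DifferentiableOn ℂ g (latticeSet τ)ᶜ)
    (hh : DifferentiableOn ℂ h (latticeSet τ)ᶜ) :
    gammaIntegral τ (fun z => g z - h z) = gammaIntegral τ g - gammaIntegral τ h :=
  intervalIntegral.integral_sub ((continuous_gamma hg).intervalIntegrable _ _)
    ((continuous_gamma hh).intervalIntegrable _ _)

theorem gammaIntegral_const_mul (c : ℂ) :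
    gammaIntegral τ (fun z => c * g z) = c * gammaIntegral τ g :=
  intervalIntegral.integral_const_mul _ _

theorem gammaIntegral_sum {ι : Type*} (s : Finset ι) {f : ι → ℂ → ℂ}
    (hf : ∀ i ∈ s, DifferentiableOn ℂ (f i) (latticeSet τ)ᶜ) :
    gammaIntegral τ (fun z => ∑ i ∈ s, f i z) = ∑ i ∈ s, gammaIntegral τ (f i) :=
  intervalIntegral.integral_finsetSum fun i hi => (continuous_gamma (hf i hi)).intervalIntegrable _ _

end Integrals

variable {τ : UpperHalfPlane}

theorem idx_ne_one (i : ℕ) : idx i ≠ 1 := by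
  unfold idx
  split_ifs <;> omega

theorem idx_lt {m i : ℕ} (hi : i < m - 1) : idx i < m := by
  unfold idx
  split_ifs <;> omega

/-- If the moment determinant does not vanish, then an elliptic polynomial of degree less than `m`
which is orthogonal to all such polynomials vanishes. -/
theorem eq_zero_of_orthogonal {m : ℕ} (hm : 2 ≤ m) (hD : momentDet τ m ≠ 0) {g : ℂ → ℂ} {c : ℂ}
    (hg : IsElliptic τ g) (hl : HasLead g (1 - m) c)
    (ho : ∀ j < m, j ≠ 1 → gammaIntegral τ (fun z => g z * ellBasis τ j z) = 0) :
    ∀ z ∉ latticeSet τ, g z = 0 := by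
  obtain ⟨v, hv⟩ := IsElliptic.exists_eq_sum (m - 1) (by omega) hg
    (by convert! hl using 1; omega)
  -- Orthogonality to each basis function says that the coefficient vector is in the left kernel of
  -- the moment matrix.
  have hv0 : (fun i : Fin (m - 1) => v i) = 0 := by
    refine Matrix.eq_zero_of_vecMul_eq_zero hD ?_
    ext j
    have h1 := ho (idx j) (idx_lt j.2) (idx_ne_one j)
    rw [gammaIntegral_congr (h := fun z => ∑ i ∈ Finset.range (m - 1),
      v i * (ellBasis τ (idx i) z * ellBasis τ (idx j) z)) (fun z hz => by
        rw [hv z hz, Finset.sum_mul]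
        exact Finset.sum_congr rfl fun i _ => mul_assoc _ _ _)] at h1
    rw [gammaIntegral_sum _ fun i _ => (((isElliptic_ellBasis τ (idx i)).mul
      (isElliptic_ellBasis τ (idx j))).const_mul (v i)).1] at h1
    simp only [gammaIntegral_const_mul] at h1
    rw [Finset.sum_range] at h1
    exact h1
  intro z hz
  rw [hv z hz, Finset.sum_range]
  apply Finset.sum_eq_zero
  intro i _
  rw [show v i = 0 from congrFun hv0 i, zero_mul]

/-! ### Jump pairs and their uniqueness -/

/-- A row of a solution of the Riemann-Hilbert problem, after continuation across the contour: an
elliptic function `x`, and a function `y` with `y (z + τ) = y z - x z`. -/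
structure IsJumpPair (τ : UpperHalfPlane) (x y : ℂ → ℂ) : Prop where
  left : IsElliptic τ x
  differentiableOn : DifferentiableOn ℂ y (latticeSet τ)ᶜ
  add_one : ∀ z ∉ latticeSet τ, y (z + 1) = y z
  add_tau : ∀ z ∉ latticeSet τ, y (z + (τ : ℂ)) = y z - x z

namespace IsJumpPair

variable {x y u v : ℂ → ℂ}

theorem differentiableAt_left (h : IsJumpPair τ x y) {z : ℂ} (hz : z ∉ latticeSet τ) :
    DifferentiableAt ℂ x z :=
  h.left.differentiableAt hz

theorem differentiableAt_right (h : IsJumpPair τ x y) {z : ℂ} (hz : z ∉ latticeSet τ) :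
    DifferentiableAt ℂ y z :=
  h.differentiableOn.differentiableAt ((isOpen_compl_latticeSet τ).mem_nhds hz)

theorem add (h : IsJumpPair τ x y) (h' : IsJumpPair τ u v) :
    IsJumpPair τ (fun z => x z + u z) (fun z => y z + v z) :=
  ⟨h.1.add h'.1, h.2.add h'.2, fun z hz => by rw [h.3 z hz, h'.3 z hz],
    fun z hz => by rw [h.4 z hz, h'.4 z hz]; ring⟩

theorem const_mul (h : IsJumpPair τ x y) (c : ℂ) :
    IsJumpPair τ (fun z => c * x z) (fun z => c * y z) :=
  ⟨h.1.const_mul c, h.2.const_mul c, fun z hz => by rw [h.3 z hz],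
    fun z hz => by rw [h.4 z hz]; ring⟩

theorem sub (h : IsJumpPair τ x y) (h' : IsJumpPair τ u v) :
    IsJumpPair τ (fun z => x z - u z) (fun z => y z - v z) := by
  simpa [sub_eq_add_neg] using h.add (h'.const_mul (-1))

theorem deriv (h : IsJumpPair τ x y) : IsJumpPair τ (deriv x) (deriv y) :=
  ⟨h.1.deriv, h.2.deriv (isOpen_compl_latticeSet τ), fun _ hz => deriv_add_eq h.3 hz,
    fun z hz => by
      rw [deriv_add_eq (h := fun z => y z - x z) h.4 hz,
        deriv_fun_sub (h.differentiableAt_right hz) (h.differentiableAt_left hz)]⟩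

/-- The sign on `y` is needed because $z\mapsto-z$ reverses the translation by $\tau$. -/
theorem comp_neg (h : IsJumpPair τ x y) :
    IsJumpPair τ (fun z => x (-z)) (fun z => -y (-z)) := by
  refine ⟨h.1.comp_neg, ?_, fun z hz => ?_, fun z hz => ?_⟩
  · have h1 : DifferentiableOn ℂ (fun z => y (-z)) (latticeSet τ)ᶜ :=
      h.2.comp differentiable_neg.differentiableOn fun z hz => fun h => hz (neg_mem_latticeSet.1 h)
    exact h1.neg
  · have h1 : -(z + 1) ∉ latticeSet τ := by rwa [neg_mem_latticeSet, add_one_mem_latticeSet]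
    rw [← h.3 _ h1]
    ring_nf
  · have h1 : -(z + (τ : ℂ)) ∉ latticeSet τ := by rwa [neg_mem_latticeSet, add_tau_mem_latticeSet]
    have h2 := h.4 _ h1
    have h3 := h.1.3 _ h1
    rw [show -(z + (τ : ℂ)) + τ = -z by ring] at h2 h3
    linear_combination h2 + h3

/-- Multiplying `y` by an elliptic function and integrating over a period strip. -/
theorem gammaIntegral_mul_eq (h : IsJumpPair τ x y) {e : ℂ → ℂ} (he : IsElliptic τ e) {c : ℂ}
    (hl : HasLead (fun z => y z * e z) (-1) c) :
    gammaIntegral τ (fun z => x z * e z) = 2 * Real.pi * Complex.I * c := by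
  have hd : DifferentiableOn ℂ (fun z => y z * e z) (latticeSet τ)ᶜ := h.2.mul he.1
  have hd' : DifferentiableOn ℂ (fun z => y z * e z + x z * e z) (latticeSet τ)ᶜ :=
    hd.add (h.1.1.mul he.1)
  rw [← gammaIntegral_sub_eq_residue hd (fun z hz => by rw [h.3 z hz, he.2 z hz]) hl]
  -- Since $y(z-\tau)=y(z)+x(z)$, the difference of the two sides of the strip is exactly the
  -- integral of $x\,e$ over $\gamma$.
  have h1 : ∀ z ∉ latticeSet τ, y (z - τ) * e (z - τ) = y z * e z + x z * e z := by
    intro z hz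
    have h0 : z - τ ∉ latticeSet τ := by rwa [← add_tau_mem_latticeSet, sub_add_cancel]
    have h2 := h.4 _ h0
    have h3 := h.1.3 _ h0
    have h4 := he.3 _ h0
    rw [sub_add_cancel] at h2 h3 h4
    rw [← h4, h2, h3]
    ring
  rw [gammaIntegral_congr h1, ← gammaIntegral_sub hd' hd]
  simp only [add_sub_cancel_left]

/-- The product $y\,\mathcal E_j$ has order at least $m-1-j\ge0$ at $0$, so its residue vanishes. -/
theorem orthogonal (h : IsJumpPair τ x y) {m : ℕ} {c : ℂ} (hy : HasLead y (m - 1) c) {j : ℕ}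
    (hj : j < m) (hj1 : j ≠ 1) : gammaIntegral τ (fun z => x z * ellBasis τ j z) = 0 := by
  have h1 := (hy.mul (hasLead_ellBasis τ hj1)).of_lt (k := -1) (by omega)
  rw [h.gammaIntegral_mul_eq (isElliptic_ellBasis τ j) h1, mul_zero]

/-- Jump pairs with the orders of the first row of the Riemann-Hilbert problem of index `m` are
proportional. -/
theorem eq_const_mul {m : ℕ} (hm : 2 ≤ m) (hD : momentDet τ m ≠ 0) {κ ρ κ' : ℂ}
    (h : IsJumpPair τ x y) (hx : HasLead x (-m) 1) (hy : HasLead y (m - 1) κ)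
    (h' : IsJumpPair τ u v) (hu : HasLead u (-m) ρ) (hv : HasLead v (m - 1) κ') :
    (∀ z ∉ latticeSet τ, u z = ρ * x z) ∧ ∀ z ∉ latticeSet τ, v z = ρ * y z := by
  have hJ := h'.sub (h.const_mul ρ)
  have hl1 := hu.sub (hx.const_mul ρ)
  have hl2 := hv.sub (hy.const_mul ρ)
  rw [mul_one, sub_self] at hl1
  obtain ⟨d, hd⟩ := hl1.succ
  have h0 := eq_zero_of_orthogonal hm hD hJ.1 (by convert! hd using 1; ring)
    fun j hj hj1 => hJ.orthogonal hl2 hj hj1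
  -- Once the first component vanishes, so does the jump of the second; its order at $0$ is at least
  -- $m-1>0$, so Liouville gives the constant $0$.
  have hE : IsElliptic τ (fun z => v z - ρ * y z) :=
    ⟨hJ.2, hJ.3, fun z hz => by rw [hJ.4 z hz, h0 z hz, sub_zero]⟩
  have h1 := hE.eq_const_of_hasLead_zero (hl2.of_lt (k := 0) (by omega))
  exact ⟨fun z hz => sub_eq_zero.1 (h0 z hz), fun z hz => sub_eq_zero.1 (h1 z hz)⟩

end IsJumpPair

/-! ### Continuation across the contour -/

/-- **Morera**: a continuous function which is holomorphic off a horizontal line is holomorphic. -/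
theorem differentiableOn_ball_of_off_line {F : ℂ → ℂ} {p : ℂ} {r : ℝ}
    (hc : ContinuousOn F (Metric.ball p r))
    (hd : ∀ w ∈ Metric.ball p r, w.im ≠ p.im → DifferentiableAt ℂ F w) :
    DifferentiableOn ℂ F (Metric.ball p r) := by
  rw [← Complex.isConservativeOn_and_continuousOn_iff_isDifferentiableOn Metric.isOpen_ball]
  refine ⟨fun z w hzw => ?_, hc⟩
  rw [← add_eq_zero_iff_eq_neg, Complex.wedgeIntegral_add_wedgeIntegral_eq]
  have key : ∀ z w : ℂ, Complex.Rectangle z w ⊆ Metric.ball p r →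
      p.im ∉ Set.Ioo (min z.im w.im) (max z.im w.im) →
      (∫ x : ℝ in z.re..w.re, F (x + z.im * Complex.I)) -
        (∫ x : ℝ in z.re..w.re, F (x + w.im * Complex.I)) +
        Complex.I • (∫ y : ℝ in z.im..w.im, F (w.re + y * Complex.I)) -
        Complex.I • (∫ y : ℝ in z.im..w.im, F (z.re + y * Complex.I)) = 0 := by
    intro z w hzw hp
    apply Complex.integral_boundary_rect_eq_zero_of_continuousOn_of_differentiableOn F z w
    · exact hc.mono hzw
    · intro u hu
      refine (hd u (hzw ⟨Set.Ioo_subset_Icc_self hu.1, Set.Ioo_subset_Icc_self hu.2⟩)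
        fun h => hp (h ▸ hu.2)).differentiableWithinAt
  -- A rectangle crossed by the line is cut along it. Each half has the line only on its boundary,
  -- where continuity suffices for Cauchy's theorem.
  by_cases hp : p.im ∈ Set.Ioo (min z.im w.im) (max z.im w.im)
  · have hp' : p.im ∈ Set.uIcc z.im w.im := Set.Ioo_subset_Icc_self hp
    have hsub1 : Complex.Rectangle z ⟨w.re, p.im⟩ ⊆ Complex.Rectangle z w := fun u hu =>
      ⟨hu.1, Set.uIcc_subset_uIcc_left hp' hu.2⟩
    have hsub2 : Complex.Rectangle ⟨z.re, p.im⟩ w ⊆ Complex.Rectangle z w := fun u hu =>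
      ⟨hu.1, Set.uIcc_subset_uIcc_right hp' hu.2⟩
    have h1 := key z ⟨w.re, p.im⟩ (hsub1.trans hzw) (by
      intro h
      rcases le_total z.im p.im with h' | h' <;> simp [h'] at h)
    have h2 := key ⟨z.re, p.im⟩ w (hsub2.trans hzw) (by
      intro h
      rcases le_total w.im p.im with h' | h' <;> simp [h'] at h)
    have hint : ∀ x ∈ Set.uIcc z.re w.re, ∀ s ∈ Set.uIcc z.im w.im, ∀ t ∈ Set.uIcc z.im w.im,
        IntervalIntegrable (fun y : ℝ => F (x + y * Complex.I)) MeasureTheory.volume s t := by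
      intro x hx s hs t ht
      apply ContinuousOn.intervalIntegrable
      refine ContinuousOn.comp (hc.mono hzw) (by fun_prop) fun y hy => ?_
      exact ⟨by simpa using hx, by simpa using Set.uIcc_subset_uIcc hs ht hy⟩
    have e1 := intervalIntegral.integral_add_adjacent_intervals
      (hint w.re Set.right_mem_uIcc _ Set.left_mem_uIcc _ hp')
      (hint w.re Set.right_mem_uIcc _ hp' _ Set.right_mem_uIcc)
    have e2 := intervalIntegral.integral_add_adjacent_intervals
      (hint z.re Set.left_mem_uIcc _ Set.left_mem_uIcc _ hp')
      (hint z.re Set.left_mem_uIcc _ hp' _ Set.right_mem_uIcc)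
    rw [← e1, ← e2]
    simp only [smul_eq_mul] at h1 h2 ⊢
    linear_combination h1 + h2
  · exact key z w hzw hp

/-- The number of the horizontal strip between two components of the contour. -/
noncomputable def stripIndex (τ : UpperHalfPlane) (z : ℂ) : ℤ := ⌊z.im / τ.im + 1 / 2⌋

/-- The shift by $1/2$ puts the contour at the jumps of the floor function and makes $0$ lie in the
strip numbered `0`. -/
theorem mem_contour {z : ℂ} : z ∈ contour τ ↔ ∃ k : ℤ, z.im / τ.im + 1 / 2 = k := by
  have hτ := τ.im_ne_zero
  constructor
  · rintro ⟨t, k, rfl⟩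
    refine ⟨k + 1, ?_⟩
    have : ((t : ℂ) + ((k : ℂ) + 1 / 2) * (τ : ℂ)).im = (k + 1 / 2) * τ.im := by
      have : ((k : ℂ) + 1 / 2) = ((k + 1 / 2 : ℝ) : ℂ) := by push_cast; ring
      rw [this, Complex.add_im, Complex.ofReal_im, Complex.im_ofReal_mul, UpperHalfPlane.coe_im,
        zero_add]
    rw [this]
    field_simp
    push_cast
    ring
  · rintro ⟨k, hk⟩
    refine ⟨z.re - (k - 1 / 2) * τ.re, k - 1, ?_⟩
    have h1 : z.im = (k - 1 / 2) * τ.im := by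
      field_simp at hk
      linarith
    have h2 : (((k - 1 : ℤ) : ℂ) + 1 / 2) = ((k - 1 / 2 : ℝ) : ℂ) := by push_cast; ring
    rw [h2]
    apply Complex.ext
    · simp
    · rw [Complex.add_im, Complex.ofReal_im, Complex.im_ofReal_mul, h1]
      simp

theorem stripIndex_lt {z : ℂ} (hz : z ∉ contour τ) :
    (stripIndex τ z : ℝ) < z.im / τ.im + 1 / 2 :=
  lt_of_le_of_ne (Int.floor_le _) fun h => hz (mem_contour.2 ⟨_, h.symm⟩)

theorem eventually_stripIndex_eq {z : ℂ} (hz : z ∉ contour τ) :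
    ∀ᶠ w in 𝓝 z, w ∉ contour τ ∧ stripIndex τ w = stripIndex τ z := by
  have hc : Continuous fun w : ℂ => w.im / τ.im + 1 / 2 := by fun_prop
  filter_upwards [hc.continuousAt.eventually (lt_mem_nhds (stripIndex_lt hz)),
    hc.continuousAt.eventually (gt_mem_nhds (Int.lt_floor_add_one (z.im / τ.im + 1 / 2)))]
    with w h1 h2
  refine ⟨fun h => ?_, Int.floor_eq_iff.2 ⟨h1.le, h2⟩⟩
  obtain ⟨k, hk⟩ := mem_contour.1 h
  rw [hk] at h1 h2
  have h3 : stripIndex τ z < k := by exact_mod_cast h1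
  have h4 : k < stripIndex τ z + 1 := by exact_mod_cast h2
  omega

theorem isOpen_compl_contour (τ : UpperHalfPlane) : IsOpen (contour τ)ᶜ :=
  isOpen_iff_mem_nhds.2 fun _ hz => (eventually_stripIndex_eq hz).mono fun _ h => h.1

theorem isOpen_domain (τ : UpperHalfPlane) : IsOpen (domain τ) := by
  rw [domain, Set.compl_union]
  exact (isOpen_compl_latticeSet τ).inter (isOpen_compl_contour τ)

theorem mem_domain {z : ℂ} : z ∈ domain τ ↔ z ∉ latticeSet τ ∧ z ∉ contour τ := by
  simp [domain]

theorem im_add_intCast (m n : ℤ) (z : ℂ) :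
    (z + (m + n * (τ : ℂ))).im / τ.im + 1 / 2 = z.im / τ.im + 1 / 2 + n := by
  have hτ := τ.im_ne_zero
  have : (z + (m + n * (τ : ℂ))).im = z.im + n * τ.im := by simp
  rw [this]
  field_simp
  ring

theorem stripIndex_add (m n : ℤ) (z : ℂ) :
    stripIndex τ (z + (m + n * (τ : ℂ))) = stripIndex τ z + n := by
  rw [stripIndex, im_add_intCast, Int.floor_add_intCast, stripIndex]

theorem add_mem_contour (m n : ℤ) (z : ℂ) : z + (m + n * (τ : ℂ)) ∈ contour τ ↔ z ∈ contour τ := by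
  simp only [mem_contour, im_add_intCast]
  exact ⟨fun ⟨k, hk⟩ => ⟨k - n, by push_cast; linarith⟩,
    fun ⟨k, hk⟩ => ⟨k + n, by push_cast; linarith⟩⟩

theorem add_mem_domain (m n : ℤ) (z : ℂ) : z + (m + n * (τ : ℂ)) ∈ domain τ ↔ z ∈ domain τ := by
  rw [mem_domain, mem_domain, add_mem_contour, add_int_mem_latticeSet]

theorem add_one_mem_domain (z : ℂ) : z + 1 ∈ domain τ ↔ z ∈ domain τ := by
  simpa using add_mem_domain (τ := τ) 1 0 z

theorem add_tau_mem_domain (z : ℂ) : z + (τ : ℂ) ∈ domain τ ↔ z ∈ domain τ := by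
  simpa using add_mem_domain (τ := τ) 0 1 z

theorem notMem_latticeSet_of_mem_contour {z : ℂ} (hz : z ∈ contour τ) : z ∉ latticeSet τ := by
  intro h
  obtain ⟨m, n, rfl⟩ := mem_latticeSet.1 h
  obtain ⟨k, hk⟩ := mem_contour.1 hz
  have h1 := im_add_intCast (τ := τ) m n 0
  rw [zero_add, hk] at h1
  simp only [Complex.zero_im, zero_div, zero_add] at h1
  have h2 : (2 * k : ℝ) = 1 + 2 * n := by linarith
  have h3 : 2 * k = 1 + 2 * n := by exact_mod_cast h2
  omega

theorem eventually_im_eq {p : ℂ} (hp : p ∈ contour τ) :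
    ∀ᶠ w in 𝓝 p, w ∈ contour τ → w.im = p.im := by
  obtain ⟨k, hk⟩ := mem_contour.1 hp
  have hc : Continuous fun w : ℂ => w.im / τ.im + 1 / 2 := by fun_prop
  filter_upwards [hc.continuousAt.eventually (lt_mem_nhds (show (k : ℝ) - 1 < p.im / τ.im + 1 / 2 by
      linarith)),
    hc.continuousAt.eventually (gt_mem_nhds (show p.im / τ.im + 1 / 2 < (k : ℝ) + 1 by
      linarith))]
    with w h1 h2 h3
  obtain ⟨l, hl⟩ := mem_contour.1 h3
  rw [hl] at h1 h2
  have h4 : k - 1 < l := by exact_mod_cast h1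
  have h5 : l < k + 1 := by exact_mod_cast h2
  have h6 : l = k := by omega
  rw [h6, ← hk] at hl
  have hτ := τ.im_ne_zero
  field_simp at hl
  linarith

theorem dense_compl_contour (τ : UpperHalfPlane) : Dense (contour τ)ᶜ := by
  intro p
  by_cases hp : p ∈ contour τ
  · rw [Metric.mem_closure_iff]
    intro ε hε
    obtain ⟨δ, hδ, h1⟩ := Metric.eventually_nhds_iff.1 (eventually_im_eq hp)
    have hm : 0 < min ε δ / 2 := by positivity
    have h2 : dist (p + (min ε δ / 2 : ℝ) * Complex.I) p = min ε δ / 2 := by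
      rw [dist_eq_norm, add_sub_cancel_left, norm_mul, Complex.norm_I, mul_one, Complex.norm_real,
        Real.norm_eq_abs, abs_of_pos hm]
    refine ⟨p + (min ε δ / 2 : ℝ) * Complex.I, fun h => ?_, ?_⟩
    · have h3 := h1 (by rw [h2]; linarith [min_le_right ε δ]) h
      rw [Complex.add_im, Complex.im_ofReal_mul, Complex.I_im] at h3
      linarith
    · rw [dist_comm, h2]
      linarith [min_le_left ε δ]
  · exact subset_closure hp

/-- Continuation of a function across the contour. -/
theorem differentiableOn_extendFrom {f : ℂ → ℂ} (hf : ∀ z ∈ domain τ, DifferentiableAt ℂ f z)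
    (hl : ∀ z ∈ contour τ, ∃ l, Tendsto f (𝓝[(contour τ)ᶜ] z) (𝓝 l)) :
    DifferentiableOn ℂ (extendFrom (contour τ)ᶜ f) (latticeSet τ)ᶜ ∧
      ∀ z ∈ domain τ, extendFrom (contour τ)ᶜ f z = f z := by
  have heq : ∀ z ∈ domain τ, extendFrom (contour τ)ᶜ f z = f z := fun z hz =>
    extendFrom_eq (dense_compl_contour τ z)
      ((hf z hz).continuousAt.tendsto.mono_left nhdsWithin_le_nhds)
  have hc : ContinuousOn (extendFrom (contour τ)ᶜ f) (latticeSet τ)ᶜ := by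
    refine continuousOn_extendFrom (fun z _ => dense_compl_contour τ z) fun z hz => ?_
    by_cases h : z ∈ contour τ
    · exact hl z h
    · exact ⟨f z, (hf z (mem_domain.2 ⟨hz, h⟩)).continuousAt.tendsto.mono_left nhdsWithin_le_nhds⟩
  have hdom : ∀ z ∈ domain τ, DifferentiableAt ℂ (extendFrom (contour τ)ᶜ f) z := fun z hz =>
    (hf z hz).congr_of_eventuallyEq (by
      filter_upwards [(isOpen_domain τ).mem_nhds hz] with w hw using heq w hw)
  refine ⟨fun z hz => ?_, heq⟩
  by_cases h : z ∈ contour τ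
  · obtain ⟨r, hr, h1⟩ := Metric.eventually_nhds_iff_ball.1
      ((eventually_im_eq h).and ((isOpen_compl_latticeSet τ).mem_nhds hz))
    have h2 := differentiableOn_ball_of_off_line (hc.mono fun w hw => (h1 w hw).2)
      fun w hw him => hdom w (mem_domain.2 ⟨(h1 w hw).2, fun h => him ((h1 w hw).1 h)⟩)
    exact (h2.differentiableAt (Metric.ball_mem_nhds z hr)).differentiableWithinAt
  · exact (hdom z (mem_domain.2 ⟨hz, h⟩)).differentiableWithinAt

theorem eq_of_eq_on_domain {f g : ℂ → ℂ} (hf : ContinuousOn f (latticeSet τ)ᶜ)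
    (hg : ContinuousOn g (latticeSet τ)ᶜ) (h : ∀ z ∈ domain τ, f z = g z) :
    ∀ z ∉ latticeSet τ, f z = g z := by
  have : Set.EqOn f g (latticeSet τ)ᶜ := by
    refine Set.EqOn.of_subset_closure h hf hg (fun z hz => (mem_domain.1 hz).1) ?_
    have := (dense_compl_contour τ).open_subset_closure_inter (isOpen_compl_latticeSet τ)
    rwa [← Set.compl_union] at this
  exact this

theorem eventually_mem_domain (τ : UpperHalfPlane) :
    ∀ᶠ z in 𝓝[≠] (0 : ℂ), z ∈ domain τ ∧ stripIndex τ z = 0 := by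
  have h0 : (0 : ℂ) ∉ contour τ := fun h =>
    notMem_latticeSet_of_mem_contour h (zero_mem_latticeSet τ)
  have h1 : stripIndex τ 0 = 0 := by
    norm_num [stripIndex]
  filter_upwards [(eventually_stripIndex_eq h0).filter_mono nhdsWithin_le_nhds,
    eventually_notMem_latticeSet τ 0] with z h2 h3
  exact ⟨mem_domain.2 ⟨h3, h2.1⟩, h2.2.trans h1⟩

theorem half_tau_add_im (t : ℝ) : ((τ : ℂ) / 2 + t).im = τ.im / 2 := by simp

theorem nhdsWithin_compl_contour_le (t : ℝ) : 𝓝[(contour τ)ᶜ] ((τ : ℂ) / 2 + t) ≤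
    𝓝[{z : ℂ | τ.im / 2 < z.im}] ((τ : ℂ) / 2 + t) ⊔
      𝓝[{z : ℂ | z.im < τ.im / 2}] ((τ : ℂ) / 2 + t) := by
  rw [← nhdsWithin_union]
  refine nhdsWithin_mono _ fun z hz => ?_
  by_contra h
  apply hz
  have h1 : z.im = τ.im / 2 := by
    by_contra h2
    exact h ((lt_or_gt_of_ne h2).symm)
  rw [mem_contour, h1]
  have := τ.im_ne_zero
  exact ⟨1, by field_simp; norm_num⟩

theorem eventually_stripIndex_above (t : ℝ) :
    ∀ᶠ z in 𝓝[{z : ℂ | τ.im / 2 < z.im}] ((τ : ℂ) / 2 + t), stripIndex τ z = 1 := by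
  have hτ := τ.im_pos
  have hc : ContinuousAt (fun w : ℂ => w.im) ((τ : ℂ) / 2 + t) := Complex.continuous_im.continuousAt
  filter_upwards [self_mem_nhdsWithin, (hc.eventually (gt_mem_nhds (show ((τ : ℂ) / 2 + t).im < τ.im by
    rw [half_tau_add_im]; linarith))).filter_mono nhdsWithin_le_nhds] with z h1 h2
  have h1 : τ.im / 2 < z.im := h1
  rw [stripIndex, Int.floor_eq_iff, Int.cast_one]
  have h3 : 1 / 2 < z.im / τ.im := by rw [lt_div_iff₀ hτ]; linarith
  have h4 : z.im / τ.im < 1 := by rw [div_lt_one hτ]; linarith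
  constructor <;> linarith

theorem eventually_stripIndex_below (t : ℝ) :
    ∀ᶠ z in 𝓝[{z : ℂ | z.im < τ.im / 2}] ((τ : ℂ) / 2 + t), stripIndex τ z = 0 := by
  have hτ := τ.im_pos
  have hc : ContinuousAt (fun w : ℂ => w.im) ((τ : ℂ) / 2 + t) := Complex.continuous_im.continuousAt
  filter_upwards [self_mem_nhdsWithin, (hc.eventually (lt_mem_nhds (show 0 < ((τ : ℂ) / 2 + t).im by
    rw [half_tau_add_im]; linarith))).filter_mono nhdsWithin_le_nhds] with z h1 h2
  have h1 : z.im < τ.im / 2 := h1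
  rw [stripIndex, Int.floor_eq_iff, Int.cast_zero]
  have h3 : z.im / τ.im < 1 / 2 := by rw [div_lt_iff₀ hτ]; linarith
  have h4 : 0 < z.im / τ.im := by positivity
  constructor <;> linarith

/-- Carries the jump condition, given only for $t\in[0,1]$, to every point of the contour. -/
theorem exists_eq_half_tau_add {z : ℂ} (hz : z ∈ contour τ) :
    ∃ t ∈ Set.Icc (0 : ℝ) 1, ∃ m n : ℤ, z = (τ : ℂ) / 2 + t + (m + n * (τ : ℂ)) := by
  obtain ⟨s, k, rfl⟩ := hz
  refine ⟨Int.fract s, ⟨Int.fract_nonneg s, (Int.fract_lt_one s).le⟩, ⌊s⌋, k, ?_⟩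
  have h1 : (s : ℂ) = (⌊s⌋ : ℂ) + (Int.fract s : ℝ) := by
    rw [← Complex.ofReal_intCast, ← Complex.ofReal_add, Int.floor_add_fract]
  rw [h1]
  ring

/-- Continuation of a row of a solution of the Riemann-Hilbert problem. -/
theorem exists_isJumpPair {x y : ℂ → ℂ} (hx : ∀ z ∈ domain τ, DifferentiableAt ℂ x z)
    (hy : ∀ z ∈ domain τ, DifferentiableAt ℂ y z)
    (x1 : ∀ z ∈ domain τ, x (z + 1) = x z) (xτ : ∀ z ∈ domain τ, x (z + (τ : ℂ)) = x z)
    (y1 : ∀ z ∈ domain τ, y (z + 1) = y z) (yτ : ∀ z ∈ domain τ, y (z + (τ : ℂ)) = y z)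
    (hj : ∀ t ∈ Set.Icc (0 : ℝ) 1, ∃ a b : ℂ,
      Tendsto x (𝓝[{z : ℂ | τ.im / 2 < z.im}] ((τ : ℂ) / 2 + (t : ℂ))) (𝓝 a) ∧
      Tendsto x (𝓝[{z : ℂ | z.im < τ.im / 2}] ((τ : ℂ) / 2 + (t : ℂ))) (𝓝 a) ∧
      Tendsto y (𝓝[{z : ℂ | τ.im / 2 < z.im}] ((τ : ℂ) / 2 + (t : ℂ))) (𝓝 (a + b)) ∧
      Tendsto y (𝓝[{z : ℂ | z.im < τ.im / 2}] ((τ : ℂ) / 2 + (t : ℂ))) (𝓝 b)) :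
    ∃ u v : ℂ → ℂ, IsJumpPair τ u v ∧
      ∀ z ∈ domain τ, x z = u z ∧ y z = v z + stripIndex τ z * u z := by
  -- Subtracting `x` once for every contour line crossed cancels the additive jump $y_+=y_-+x$; the
  -- price is $w(z+\tau)=w(z)-x(z)$.
  set w : ℂ → ℂ := fun z => y z - stripIndex τ z * x z with hw
  have per : ∀ {f : ℂ → ℂ}, (∀ z ∈ domain τ, f (z + 1) = f z) →
      (∀ z ∈ domain τ, f (z + (τ : ℂ)) = f z) → ∀ m n : ℤ, ∀ z ∈ domain τ,
      f (z + (m + n * (τ : ℂ))) = f z := by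
    intro f f1 fτ m n z hz
    obtain ⟨h1, h2⟩ := add_intCast_mul_eq add_tau_mem_domain fτ n z hz
    have h3 := (add_intCast_mul_eq add_one_mem_domain f1 m _ h1).2
    rw [← h2, ← h3]
    ring_nf
  have wper : ∀ m n : ℤ, ∀ z ∈ domain τ, w (z + (m + n * (τ : ℂ))) = w z - n * x z := by
    intro m n z hz
    simp only [hw, per x1 xτ m n z hz, per y1 yτ m n z hz, stripIndex_add]
    push_cast
    ring
  have hwd : ∀ z ∈ domain τ, DifferentiableAt ℂ w z := by
    intro z hz
    have h1 : DifferentiableAt ℂ (fun u => y u - stripIndex τ z * x u) z :=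
      (hy z hz).sub ((hx z hz).const_mul _)
    refine h1.congr_of_eventuallyEq ?_
    filter_upwards [eventually_stripIndex_eq (mem_domain.1 hz).2] with u hu
    simp only [hw, hu.2]
  have lim : ∀ z ∈ contour τ, ∃ a b, Tendsto x (𝓝[(contour τ)ᶜ] z) (𝓝 a) ∧
      Tendsto w (𝓝[(contour τ)ᶜ] z) (𝓝 b) := by
    intro z hz
    obtain ⟨t, ht, m, n, rfl⟩ := exists_eq_half_tau_add hz
    obtain ⟨a, b, h1, h2, h3, h4⟩ := hj t ht
    have hxt : Tendsto x (𝓝[(contour τ)ᶜ] ((τ : ℂ) / 2 + t)) (𝓝 a) :=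
      (h1.sup h2).mono_left (nhdsWithin_compl_contour_le t)
    have h5 : Tendsto w (𝓝[{z : ℂ | τ.im / 2 < z.im}] ((τ : ℂ) / 2 + t)) (𝓝 b) := by
      have := h3.sub h1
      rw [add_sub_cancel_left] at this
      refine this.congr' ?_
      filter_upwards [eventually_stripIndex_above t] with u hu
      simp [hw, hu]
    have h6 : Tendsto w (𝓝[{z : ℂ | z.im < τ.im / 2}] ((τ : ℂ) / 2 + t)) (𝓝 b) := by
      refine h4.congr' ?_
      filter_upwards [eventually_stripIndex_below t] with u hu
      simp [hw, hu]
    have hwt : Tendsto w (𝓝[(contour τ)ᶜ] ((τ : ℂ) / 2 + t)) (𝓝 b) :=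
      (h5.sup h6).mono_left (nhdsWithin_compl_contour_le t)
    have hshift : Tendsto (fun u : ℂ => u - (m + n * (τ : ℂ)))
        (𝓝[(contour τ)ᶜ] ((τ : ℂ) / 2 + t + (m + n * (τ : ℂ))))
        (𝓝[(contour τ)ᶜ] ((τ : ℂ) / 2 + t)) := by
      refine tendsto_nhdsWithin_iff.2 ⟨?_, ?_⟩
      · exact ((continuous_id.sub continuous_const).tendsto' _ _ (by simp)).mono_left
          nhdsWithin_le_nhds
      · filter_upwards [self_mem_nhdsWithin] with u hu
        intro h
        apply hu
        rwa [← add_mem_contour m n, sub_add_cancel] at h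
    have hdom : ∀ᶠ u in 𝓝[(contour τ)ᶜ] ((τ : ℂ) / 2 + t + (m + n * (τ : ℂ))),
        u - (m + n * (τ : ℂ)) ∈ domain τ := by
      filter_upwards [self_mem_nhdsWithin, nhdsWithin_le_nhds
        ((isOpen_compl_latticeSet τ).mem_nhds (notMem_latticeSet_of_mem_contour hz))] with u h1 h2
      rw [← add_mem_domain m n, sub_add_cancel]
      exact mem_domain.2 ⟨h2, h1⟩
    refine ⟨a, b - n * a, (hxt.comp hshift).congr' ?_,
      ((hwt.comp hshift).sub ((hxt.comp hshift).const_mul _)).congr' ?_⟩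
    · filter_upwards [hdom] with u hu
      rw [Function.comp_apply, ← per x1 xτ m n _ hu, sub_add_cancel]
    · filter_upwards [hdom] with u hu
      rw [Function.comp_apply, Function.comp_apply, ← wper m n _ hu, sub_add_cancel]
  obtain ⟨hu1, hu2⟩ := differentiableOn_extendFrom hx fun z hz =>
    let ⟨a, _, h, _⟩ := lim z hz; ⟨a, h⟩
  obtain ⟨hv1, hv2⟩ := differentiableOn_extendFrom hwd fun z hz =>
    let ⟨_, b, _, h⟩ := lim z hz; ⟨b, h⟩
  set u := extendFrom (contour τ)ᶜ x
  set v := extendFrom (contour τ)ᶜ w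
  have hshift : ∀ {f : ℂ → ℂ}, ContinuousOn f (latticeSet τ)ᶜ → ∀ m n : ℤ,
      ContinuousOn (fun z => f (z + (m + n * (τ : ℂ)))) (latticeSet τ)ᶜ := fun hf m n =>
    hf.comp (by fun_prop) fun z hz h => hz ((add_int_mem_latticeSet m n).1 h)
  have huper : ∀ m n : ℤ, ∀ z ∉ latticeSet τ, u (z + (m + n * (τ : ℂ))) = u z := fun m n =>
    eq_of_eq_on_domain (hshift hu1.continuousOn m n) hu1.continuousOn fun z hz => by
      rw [hu2 _ ((add_mem_domain m n z).2 hz), hu2 _ hz, per x1 xτ m n z hz]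
  have hvper : ∀ m n : ℤ, ∀ z ∉ latticeSet τ, v (z + (m + n * (τ : ℂ))) = v z - n * u z :=
    fun m n => eq_of_eq_on_domain (hshift hv1.continuousOn m n)
      (hv1.continuousOn.sub (hu1.continuousOn.const_mul _)) fun z hz => by
      rw [hv2 _ ((add_mem_domain m n z).2 hz), hv2 _ hz, hu2 _ hz, wper m n z hz]
  refine ⟨u, v, ⟨⟨hu1, ?_, ?_⟩, hv1, ?_, ?_⟩, fun z hz => ⟨(hu2 z hz).symm, ?_⟩⟩
  · simpa using huper 1 0
  · simpa using huper 0 1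
  · simpa using hvper 1 0
  · simpa using hvper 0 1
  · rw [hv2 z hz, hu2 z hz]
    simp [hw]

/-! ### Rows of the Riemann–Hilbert solution and relations between neighbouring indices -/

/-- The two rows of the solution of the Riemann-Hilbert problem of index `n`, after continuation
across the contour. -/
structure IsRHPRows (τ : UpperHalfPlane) (n : ℕ) (a b c d : ℂ → ℂ) (κ γ : ℂ) : Prop where
  fst : IsJumpPair τ a b
  snd : IsJumpPair τ c d
  lead_a : HasLead a (-n) 1
  lead_b : HasLead b (n - 1) κ
  lead_c : HasLead c (1 - n) γ
  lead_d : HasLead d (n - 2) 1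

theorem IsRHPSolution.exists_rows {τ : UpperHalfPlane} {n : ℕ}
    {Y : ℂ → Matrix (Fin 2) (Fin 2) ℂ} (hY : IsRHPSolution τ n Y) :
    ∃ (a b c d : ℂ → ℂ) (κ γ : ℂ), IsRHPRows τ n a b c d κ γ ∧
      ∀ z ∈ domain τ, Y z = !![a z, b z + stripIndex τ z * a z;
        c z, d z + stripIndex τ z * c z] := by
  have hrow : ∀ i, ∃ u v : ℂ → ℂ, IsJumpPair τ u v ∧
      ∀ z ∈ domain τ, Y z i 0 = u z ∧ Y z i 1 = v z + stripIndex τ z * u z := by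
    intro i
    refine exists_isJumpPair (x := fun z => Y z i 0) (y := fun z => Y z i 1)
      (fun z hz => (hY.analytic i 0 z hz).differentiableAt)
      (fun z hz => (hY.analytic i 1 z hz).differentiableAt)
      (fun z hz => by rw [hY.add_one z hz]) (fun z hz => by rw [hY.add_tau z hz])
      (fun z hz => by rw [hY.add_one z hz]) (fun z hz => by rw [hY.add_tau z hz]) fun t ht => ?_
    obtain ⟨Yp, Ym, h1, h2, h3⟩ := hY.jump t ht
    have e0 : Yp i 0 = Ym i 0 := by rw [h3]; simp [Matrix.mul_apply]
    have e1 : Yp i 1 = Ym i 0 + Ym i 1 := by rw [h3]; simp [Matrix.mul_apply]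
    have ev : ∀ {F : Filter ℂ} {M : Matrix (Fin 2) (Fin 2) ℂ}, Tendsto Y F (𝓝 M) → ∀ j,
        Tendsto (fun z => Y z i j) F (𝓝 (M i j)) := fun h j =>
      tendsto_pi_nhds.1 (tendsto_pi_nhds.1 h i) j
    exact ⟨Ym i 0, Ym i 1, e0 ▸ ev h1 0, ev h2 0, e1 ▸ ev h1 1, ev h2 1⟩
  obtain ⟨a, b, hab, h0⟩ := hrow 0
  obtain ⟨c, d, hcd, h1⟩ := hrow 1
  have near : ∀ {i : Fin 2} {u v : ℂ → ℂ}, (∀ z ∈ domain τ, Y z i 0 = u z ∧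
      Y z i 1 = v z + stripIndex τ z * u z) →
      ∀ᶠ z in 𝓝[≠] (0 : ℂ), Y z i 0 = u z ∧ Y z i 1 = v z := by
    intro i u v h
    filter_upwards [eventually_mem_domain τ] with z hz
    simpa [hz.2] using h z hz.1
  have la : HasLead a (-n) 1 := by
    refine HasLead.of_isBigO (eventually_differentiableAt hab.left.1 0) ?_
    refine (hY.asymptotic 0 0).congr' ?_ EventuallyEq.rfl
    filter_upwards [near h0] with z hz
    simp [Matrix.mul_apply, hz.1, mul_comm]
  -- The off-diagonal entries of $\mathbb 1+\mathcal O(z)$ are $\mathcal O(z)$: the coefficient at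
  -- this order is `0`, and `HasLead.succ` below gains one order. The new coefficients are `κ` and
  -- `γ`.
  have lb : HasLead b (n - 2) 0 := by
    refine HasLead.of_isBigO (eventually_differentiableAt hab.2 0) ?_
    refine (hY.asymptotic 0 1).congr' ?_ EventuallyEq.rfl
    filter_upwards [near h0] with z hz
    simp [Matrix.mul_apply, hz.2, mul_comm]
  have lc : HasLead c (-n) 0 := by
    refine HasLead.of_isBigO (eventually_differentiableAt hcd.left.1 0) ?_
    refine (hY.asymptotic 1 0).congr' ?_ EventuallyEq.rfl
    filter_upwards [near h1] with z hz
    simp [Matrix.mul_apply, hz.1, mul_comm]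
  have ld : HasLead d (n - 2) 1 := by
    refine HasLead.of_isBigO (eventually_differentiableAt hcd.2 0) ?_
    refine (hY.asymptotic 1 1).congr' ?_ EventuallyEq.rfl
    filter_upwards [near h1] with z hz
    simp [Matrix.mul_apply, hz.2, mul_comm]
  obtain ⟨κ, lb⟩ := lb.succ
  obtain ⟨γ, lc⟩ := lc.succ
  refine ⟨a, b, c, d, κ, γ, ⟨hab, hcd, la, ?_, ?_, ld⟩, fun z hz => ?_⟩
  · convert! lb using 1
    ring
  · convert! lc using 1
    ring
  · rw [Matrix.eta_fin_two (Y z), (h0 z hz).1, (h0 z hz).2, (h1 z hz).1, (h1 z hz).2]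

namespace IsRHPRows

variable {τ : UpperHalfPlane} {n : ℕ} {a b c d A B C D : ℂ → ℂ} {κ γ κ' γ' : ℂ}

/-- The jump terms cancel in the determinant, which is therefore elliptic with leading term
$z^{-2}$; after subtracting $\wp$ at most a simple pole is left, and that has residue zero. -/
theorem exists_det_eq (R : IsRHPRows τ n a b c d κ γ) :
    ∃ α, ∀ z ∉ latticeSet τ, a z * d z - b z * c z = wp τ z + α := by
  have hE : IsElliptic τ (fun z => a z * d z - b z * c z) := by
    refine ⟨(R.fst.1.1.mul R.snd.2).sub (R.fst.2.mul R.snd.1.1), fun z hz => ?_, fun z hz => ?_⟩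
    · rw [R.fst.1.2 z hz, R.fst.3 z hz, R.snd.1.2 z hz, R.snd.3 z hz]
    · rw [R.fst.1.3 z hz, R.fst.4 z hz, R.snd.1.3 z hz, R.snd.4 z hz]
      ring
  have h1 : HasLead (fun z => a z * d z) (-2) 1 := by
    convert! R.lead_a.mul R.lead_d using 1 <;> ring
  have h2 : HasLead (fun z => b z * c z) (-2) 0 := (R.lead_b.mul R.lead_c).of_lt (by omega)
  have h3 := (h1.sub h2).sub (hasLead_wp τ)
  rw [sub_zero, sub_self] at h3
  obtain ⟨e, he⟩ := h3.succ
  obtain ⟨α, hα⟩ := (hE.sub (isElliptic_wp τ)).eq_const_of_hasLead_neg_one he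
  exact ⟨α, fun z hz => by linear_combination hα z hz⟩

theorem gammaIntegral_sq (R : IsRHPRows τ n a b c d κ γ) :
    gammaIntegral τ (fun z => a z ^ 2) = 2 * Real.pi * Complex.I * κ := by
  simp only [sq]
  refine R.fst.gammaIntegral_mul_eq R.fst.1 ?_
  convert! R.lead_b.mul R.lead_a using 1 <;> ring

/-- The first entry is the elliptic orthogonal polynomial. -/
theorem eq_of_isEOP (R : IsRHPRows τ n a b c d κ γ) (hn : 2 ≤ n) (hD : momentDet τ n ≠ 0)
    {p : ℂ → ℂ} (hp : IsEOP τ n p) : ∀ z ∉ latticeSet τ, p z = a z := by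
  have hpE : IsElliptic τ p := ⟨hp.1.1, hp.1.2, hp.1.3⟩
  have hpl : HasLead p (-n) 1 :=
    HasLead.of_isBigO (eventually_differentiableAt hpE.1 0) (by simpa using hp.1.4)
  have h1 := hpl.sub R.lead_a
  rw [sub_self] at h1
  obtain ⟨e, he⟩ := h1.succ
  have h2 := eq_zero_of_orthogonal hn hD (hpE.sub R.fst.1) (by convert! he using 1; ring)
    fun j hj hj1 => by
      have hE := isElliptic_ellBasis τ j
      simp only [sub_mul]
      rw [gammaIntegral_sub (hpE.mul hE).1 (R.fst.1.mul hE).1, hp.2 j hj hj1,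
        R.fst.orthogonal R.lead_b hj hj1, sub_zero]
  exact fun z hz => sub_eq_zero.1 (h2 z hz)

/-- The second row of the next solution is a multiple of the first row. -/
theorem next_snd_eq (R : IsRHPRows τ n a b c d κ γ) (hn : 2 ≤ n) (hD : momentDet τ n ≠ 0)
    (R' : IsRHPRows τ (n + 1) A B C D κ' γ') :
    γ' * κ = 1 ∧ ∀ z ∉ latticeSet τ, C z = γ' * a z ∧ D z = γ' * b z := by
  have hC : HasLead C (-n) γ' := by
    convert! R'.lead_c using 1
    push_cast
    ring
  have hDl : HasLead D (n - 1) 1 := by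
    convert! R'.lead_d using 1
    push_cast
    ring
  obtain ⟨h1, h2⟩ := R.fst.eq_const_mul hn hD R.lead_a R.lead_b R'.snd hC hDl
  refine ⟨?_, fun z hz => ⟨h1 z hz, h2 z hz⟩⟩
  -- Compare the coefficients of $z^{n-1}$ in $D=\gamma' b$.
  refine HasLead.unique (g := D) ?_ hDl
  refine (R.lead_b.const_mul γ').congr ?_
  filter_upwards [eventually_notMem_latticeSet τ 0] with z hz using h2 z hz

/-- The derivative of the first row, in terms of the rows of this and of the next solution. -/
theorem exists_deriv_fst_eq (R : IsRHPRows τ n a b c d κ γ) (hn : 2 ≤ n) (hD : momentDet τ n ≠ 0)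
    (R' : IsRHPRows τ (n + 1) A B C D κ' γ') :
    ∃ ρ : ℂ, ∀ z ∉ latticeSet τ,
      deriv a z + n * A z - (n - 1) * κ * c z = ρ * a z ∧
      deriv b z + n * B z - (n - 1) * κ * d z = ρ * b z := by
  have hJ := (R.fst.deriv.add (R'.fst.const_mul n)).sub (R.snd.const_mul ((n - 1) * κ))
  -- The coefficients are chosen to cancel the leading terms $-nz^{-n-1}$ of $a'$ and $(n-1)\kappa
  -- z^{n-2}$ of $b'$, which brings the orders back to those of $(a,b)$.
  have l1 : HasLead (fun z => deriv a z + n * A z - (n - 1) * κ * c z) (-n - 1) 0 := by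
    have h1 := R.lead_a.deriv
    have h2 : HasLead A (-n - 1) 1 := by
      convert! R'.lead_a using 1
      push_cast
      ring
    have h3 : HasLead c (-n - 1) 0 := R.lead_c.of_lt (by omega)
    convert! (h1.add (h2.const_mul n)).sub (h3.const_mul ((n - 1) * κ)) using 1
    push_cast
    ring
  have l2 : HasLead (fun z => deriv b z + n * B z - (n - 1) * κ * d z) (n - 2) 0 := by
    have h1 : HasLead (deriv b) (n - 2) ((n - 1) * κ) := by
      convert! R.lead_b.deriv using 1
      · ring
      · push_cast
        ring
    have h2 : HasLead B (n - 2) 0 := R'.lead_b.of_lt (by push_cast; omega)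
    convert! (h1.add (h2.const_mul n)).sub (R.lead_d.const_mul ((n - 1) * κ)) using 1
    ring
  obtain ⟨ρ, l1⟩ := l1.succ
  obtain ⟨σ, l2⟩ := l2.succ
  obtain ⟨h1, h2⟩ := R.fst.eq_const_mul hn hD R.lead_a R.lead_b hJ
    (by convert! l1 using 1; ring) (by convert! l2 using 1; ring)
  exact ⟨ρ, fun z hz => ⟨h1 z hz, h2 z hz⟩⟩

/-- Reflection gives another jump pair with the same orders, so uniqueness applies. -/
theorem fst_parity (R : IsRHPRows τ n a b c d κ γ) (hn : 2 ≤ n) (hD : momentDet τ n ≠ 0) :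
    ∀ z ∉ latticeSet τ, a (-z) = (-1) ^ n * a z ∧ b (-z) = -(-1) ^ n * b z := by
  have h1 : HasLead (fun z => a (-z)) (-n) ((-1) ^ n) := by
    simpa [← inv_pow, inv_neg] using R.lead_a.comp_neg
  have h2 := R.lead_b.comp_neg.const_mul (-1)
  obtain ⟨h3, h4⟩ := R.fst.eq_const_mul hn hD R.lead_a R.lead_b R.fst.comp_neg h1
    (by simpa only [neg_one_mul (b _)] using h2)
  exact fun z hz => ⟨h3 z hz, by linear_combination -h4 z hz⟩

end IsRHPRows

/-! ### Parity and the entries of $Y'\,\mathrm{adj}\,Y$ -/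

/-- The derivative of a relation `g (-z) = s * g z` off the lattice. -/
theorem deriv_neg_eq {τ : UpperHalfPlane} {g : ℂ → ℂ} {s : ℂ}
    (H : ∀ z ∉ latticeSet τ, g (-z) = s * g z) :
    ∀ z ∉ latticeSet τ, deriv g (-z) = -s * deriv g z := by
  intro z hz
  have h1 : (fun u => g (-u)) =ᶠ[𝓝 z] fun u => s * g u := by
    filter_upwards [(isOpen_compl_latticeSet τ).mem_nhds hz] with u hu using H u hu
  have h2 := h1.deriv_eq
  rw [deriv_comp_neg, deriv_const_mul_field] at h2
  linear_combination -h2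

/-- An odd elliptic function with a pole of order at most three. -/
theorem IsElliptic.eq_of_odd {τ : UpperHalfPlane} {g : ℂ → ℂ} {c : ℂ} (hg : IsElliptic τ g)
    (hl : HasLead g (-3) c) (hodd : ∀ z ∉ latticeSet τ, g (-z) = -g z) :
    ∀ z ∉ latticeSet τ, g z = -(c / 2) * wp' τ z := by
  have hodd' : ∀ z ∉ latticeSet τ, g (-z) - -(c / 2) * wp' τ (-z) =
      -(g z - -(c / 2) * wp' τ z) := by
    intro z hz
    rw [hodd z hz, wp', wp', PeriodPair.derivWeierstrassP_neg]
    ring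
  have h1 := hl.sub ((hasLead_wp' τ).const_mul (-(c / 2)))
  rw [show c - -(c / 2) * -2 = 0 by ring] at h1
  have hE := hg.sub ((isElliptic_wp' τ).const_mul (-(c / 2)))
  obtain ⟨e, he⟩ := h1.succ
  -- An odd function has no $z^{-2}$ term. What remains has at most a simple pole, so it is
  -- constant, and oddness makes it zero.
  have he0 : e = 0 := by
    have h2 := he.comp_neg
    have h3 : HasLead (fun z => g (-z) - -(c / 2) * wp' τ (-z)) (-3 + 1) (-1 * e) := by
      refine (he.const_mul (-1)).congr ?_
      filter_upwards [eventually_notMem_latticeSet τ 0] with z hz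
      rw [hodd' z hz]
      ring
    have h4 := h2.unique h3
    norm_num at h4
    have h5 : (2 : ℂ) * e = 0 := by linear_combination h4
    simpa using h5
  rw [he0] at he
  obtain ⟨e', he'⟩ := he.succ
  obtain ⟨k, hk⟩ := hE.eq_const_of_hasLead_neg_one he'
  intro z hz
  have h2 := hodd' z hz
  rw [hk _ (fun h => hz (neg_mem_latticeSet.1 h)), hk z hz] at h2
  have h3 : k = 0 := by
    have : (2 : ℂ) * k = 0 := by linear_combination h2
    simpa using this
  rw [← sub_eq_zero, hk z hz, h3]

namespace IsRHPRows

variable {τ : UpperHalfPlane} {n : ℕ} {p q r s a b c d A B C D : ℂ → ℂ}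
  {κ₀ γ₀ κ γ κ' γ' : ℂ}

/-- The diagonal of the matrix `Y' adj Y`. -/
theorem deriv_mul_sub_eq (R₀ : IsRHPRows τ n p q r s κ₀ γ₀)
    (R : IsRHPRows τ (n + 1) a b c d κ γ) (hn : 2 ≤ n) (hD₀ : momentDet τ n ≠ 0)
    (hD : momentDet τ (n + 1) ≠ 0) : ∀ z ∉ latticeSet τ,
    deriv a z * d z - deriv b z * c z = ((n + 1 : ℕ) : ℂ) / 2 * wp' τ z := by
  have hE : IsElliptic τ (fun z => deriv a z * d z - deriv b z * c z) := by
    have h1 := R.fst.deriv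
    refine ⟨(h1.1.1.mul R.snd.2).sub (h1.2.mul R.snd.1.1), fun z hz => ?_, fun z hz => ?_⟩
    · rw [h1.1.2 z hz, h1.3 z hz, R.snd.1.2 z hz, R.snd.3 z hz]
    · rw [h1.1.3 z hz, h1.4 z hz, R.snd.1.3 z hz, R.snd.4 z hz]
      ring
  have hl : HasLead (fun z => deriv a z * d z - deriv b z * c z) (-3) (-((n + 1 : ℕ) : ℂ)) := by
    have h1 : HasLead (fun z => deriv a z * d z) (-3) (-((n + 1 : ℕ) : ℂ)) := by
      convert! R.lead_a.deriv.mul R.lead_d using 1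
      · ring
      · simp
    have h2 : HasLead (fun z => deriv b z * c z) (-3) 0 :=
      (R.lead_b.deriv.mul R.lead_c).of_lt (by omega)
    simpa using h1.sub h2
  -- The row $(c,d)$ is a multiple of the first row of index `n`, so it has the parity opposite to
  -- that of $(a,b)$; this makes the expression odd.
  obtain ⟨-, hcd⟩ := R₀.next_snd_eq hn hD₀ R
  have h0 := R₀.fst_parity hn hD₀
  have h1 := R.fst_parity (by omega) hD
  have ha := deriv_neg_eq fun z hz => (h1 z hz).1
  have hb := deriv_neg_eq fun z hz => (h1 z hz).2
  have hsq : ((-1 : ℂ) ^ n) ^ 2 = 1 := by rw [← pow_mul, mul_comm, pow_mul]; simp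
  intro z hz
  rw [hE.eq_of_odd hl _ z hz]
  · ring
  · intro z hz
    have hz' : -z ∉ latticeSet τ := fun h => hz (neg_mem_latticeSet.1 h)
    rw [(hcd z hz).1, (hcd z hz).2, (hcd _ hz').1, (hcd _ hz').2, (h0 z hz).1, (h0 z hz).2,
      ha z hz, hb z hz, pow_succ]
    linear_combination (γ * (deriv b z * p z - deriv a z * q z)) * hsq

/-- The equation `f Y' = (f L) Y`, where `f = det Y`. -/
theorem det_mul_deriv_eq (R₀ : IsRHPRows τ n p q r s κ₀ γ₀)
    (R : IsRHPRows τ (n + 1) a b c d κ γ) (R' : IsRHPRows τ (n + 1 + 1) A B C D κ' γ')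
    (hn : 2 ≤ n) (hD₀ : momentDet τ n ≠ 0) (hD : momentDet τ (n + 1) ≠ 0) {α₀ α α' : ℂ}
    (hf₀ : ∀ z ∉ latticeSet τ, p z * s z - q z * r z = wp τ z + α₀)
    (hf : ∀ z ∉ latticeSet τ, a z * d z - b z * c z = wp τ z + α)
    (hf' : ∀ z ∉ latticeSet τ, A z * D z - B z * C z = wp τ z + α')
    {z : ℂ} (hz : z ∉ latticeSet τ) :
    ((wp τ z + α) * deriv a z = (n + 1) / 2 * wp' τ z * a z +
      κ * (n * (wp τ z + α) + (n + 1) * (wp τ z + α')) * c z) ∧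
    ((wp τ z + α) * deriv b z = (n + 1) / 2 * wp' τ z * b z +
      κ * (n * (wp τ z + α) + (n + 1) * (wp τ z + α')) * d z) ∧
    ((wp τ z + α) * deriv c z = γ * ((1 - n) * (wp τ z + α₀) - n * (wp τ z + α)) * a z +
      (1 - n) / 2 * wp' τ z * c z) ∧
    ((wp τ z + α) * deriv d z = γ * ((1 - n) * (wp τ z + α₀) - n * (wp τ z + α)) * b z +
      (1 - n) / 2 * wp' τ z * d z) := by
  have hU := (isOpen_compl_latticeSet τ).mem_nhds hz
  have h11 := deriv_mul_sub_eq R₀ R hn hD₀ hD z hz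
  obtain ⟨hγ, hcd⟩ := R₀.next_snd_eq hn hD₀ R
  obtain ⟨hγ', hCD⟩ := R.next_snd_eq (by omega) hD R'
  obtain ⟨ρ₀, hρ₀⟩ := R₀.exists_deriv_fst_eq hn hD₀ R
  obtain ⟨ρ, hρ⟩ := R.exists_deriv_fst_eq (by omega) hD R'
  have hc : deriv c z = γ * deriv p z := by
    rw [← deriv_const_mul_field]
    apply Filter.EventuallyEq.deriv_eq
    filter_upwards [hU] with u hu using (hcd u hu).1
  have hd : deriv d z = γ * deriv q z := by
    rw [← deriv_const_mul_field]
    apply Filter.EventuallyEq.deriv_eq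
    filter_upwards [hU] with u hu using (hcd u hu).2
  -- The trace of $Y'\,\mathrm{adj}\,Y$ is $(\det Y)'=\wp'$.
  have htr : (deriv a z * d z + a z * deriv d z) - (deriv b z * c z + b z * deriv c z) =
      wp' τ z := by
    have h1 : (fun u => a u * d u - b u * c u) =ᶠ[𝓝 z] fun u => wp τ u + α := by
      filter_upwards [hU] with u hu using hf u hu
    have h2 := h1.deriv_eq
    rw [deriv_add_const, deriv_wp, deriv_fun_sub, deriv_fun_mul, deriv_fun_mul] at h2
    · exact h2
    · exact R.fst.differentiableAt_right hz
    · exact R.snd.differentiableAt_left hz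
    · exact R.fst.differentiableAt_left hz
    · exact R.snd.differentiableAt_right hz
    · exact (R.fst.differentiableAt_left hz).mul (R.snd.differentiableAt_right hz)
    · exact (R.fst.differentiableAt_right hz).mul (R.snd.differentiableAt_left hz)
  obtain ⟨hp, hq⟩ := hρ₀ z hz
  obtain ⟨ha, hb⟩ := hρ z hz
  obtain ⟨hcz, hdz⟩ := hcd z hz
  obtain ⟨hCz, hDz⟩ := hCD z hz
  have f₀ := hf₀ z hz
  have f := hf z hz
  have f' := hf' z hz
  push_cast at h11 hp hq ha hb
  -- In this minor the term with `ρ` drops out, and $\gamma'\kappa=1$ turns $Ab-Ba$ into $\kappa\det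
  -- Y_{n+2}$.
  have h12 : a z * deriv b z - deriv a z * b z =
      κ * (n * (wp τ z + α) + (n + 1) * (wp τ z + α')) := by
    rw [← f, ← f', hCz, hDz]
    linear_combination a z * hb - b z * ha - (n + 1) * (A z * b z - B z * a z) * hγ'
  -- Here $(c,d)'=\gamma(p,q)'$, and the derivative formula of index `n` applies; $\gamma\kappa_0=1$
  -- turns $\kappa_0(rd-sc)$ into $-(ps-qr)$.
  have h21 : deriv c z * d z - deriv d z * c z =
      γ * ((1 - n) * (wp τ z + α₀) - n * (wp τ z + α)) := by
    rw [← f₀, ← f, hc, hd]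
    linear_combination γ * d z * hp - γ * c z * hq + γ * ρ₀ * (p z * hdz - q z * hcz) +
      γ * (n - 1) * κ₀ * (r z * hdz - s z * hcz) + γ * (n - 1) * (r z * q z - s z * p z) * hγ
  have h22 : a z * deriv d z - b z * deriv c z = (1 - n) / 2 * wp' τ z := by
    linear_combination htr - h11
  -- Multiply on the right by $Y$: $(Y'\,\mathrm{adj}\,Y)\,Y=\det Y\cdot Y'$.
  refine ⟨?_, ?_, ?_, ?_⟩
  · rw [← h12, ← h11, ← f]
    ring
  · rw [← h12, ← h11, ← f]
    ring
  · rw [← h21, ← h22, ← f]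
    ring
  · rw [← h21, ← h22, ← f]
    ring

end IsRHPRows

/-! ### The scalar second-order equation and the theorem -/

/-- Elimination of the second component of a linear system of two equations of first order. -/
theorem deriv_deriv_eq_of_system {a c l g f f' D : ℂ → ℂ} {z κ N L₁₀ L₁₁ : ℂ}
    (hl : ∀ w, l w = N * D w / (2 * f w)) (hg : ∀ w, g w = f' w / f w)
    (hld : DifferentiableAt ℂ l z) (hgd : DifferentiableAt ℂ g z)
    (ha : DifferentiableAt ℂ a z) (hc : DifferentiableAt ℂ c z)
    (hsys : ∀ᶠ w in 𝓝 z, deriv a w = l w * a w + κ * ((N - 1) + N * g w) * c w)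
    (hc' : deriv c z = L₁₀ * a z + L₁₁ * c z) (htr : l z + L₁₁ = D z / f z)
    (hf : f z ≠ 0) (hT : (N - 1) * f z + N * f' z ≠ 0) :
    deriv (deriv a) z = (D z / f z + N * deriv g z * ((N - 1) + N * g z)⁻¹) * deriv a z +
      (deriv l z - N * deriv g z * (N * D z / (2 * ((N - 1) * f z + N * f' z))) -
        (l z * L₁₁ - κ * ((N - 1) + N * g z) * L₁₀)) * a z := by
  -- In the application `f'` is $f_{n+1}$, not a derivative; `T` is, up to the factor `κ`, the upper
  -- right entry of $L_n$.
  have hgT : (N - 1) * f z + N * f' z = f z * ((N - 1) + N * g z) := by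
    rw [hg]
    field_simp
  set T := (N - 1) + N * g z with hTdef
  have hT0 : T ≠ 0 := fun h => hT (by rw [hgT, h, mul_zero])
  have h1 : HasDerivAt (fun w => l w * a w + κ * ((N - 1) + N * g w) * c w)
      (deriv l z * a z + l z * deriv a z + (κ * (N * deriv g z) * c z + κ * T * deriv c z)) z :=
    (hld.hasDerivAt.mul ha.hasDerivAt).add
      ((((hgd.hasDerivAt.const_mul N).const_add (N - 1)).const_mul κ).mul hc.hasDerivAt)
  have h2 : deriv (deriv a) z = _ := (EventuallyEq.deriv_eq hsys).trans h1.deriv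
  -- Since `T` does not vanish, the first equation of the system can be solved for the second
  -- unknown.
  have h3 : κ * c z = (deriv a z - l z * a z) / T := by
    rw [eq_div_iff hT0, hsys.self_of_nhds]
    ring
  have h4 : N * D z / (2 * ((N - 1) * f z + N * f' z)) = l z / T := by
    rw [hgT, hl]
    field_simp
  rw [h2, h4, hc', ← htr]
  have h5 : κ * (N * deriv g z) * c z + κ * T * (L₁₀ * a z + L₁₁ * c z) =
      N * deriv g z * (κ * c z) + κ * T * L₁₀ * a z + T * L₁₁ * (κ * c z) := by ring
  rw [h5, h3]
  field_simp
  ring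

end EllipticOP

theorem proposition3p2 (τ : UpperHalfPlane) (n : ℕ) (hn : 3 ≤ n)
    (hDprev : EllipticOP.momentDet τ (n - 1) ≠ 0)
    (hD : EllipticOP.momentDet τ n ≠ 0)
    (hDnext : EllipticOP.momentDet τ (n + 1) ≠ 0)
    -- the solutions of the Riemann-Hilbert problems of index `n - 1`, `n`, `n + 1`
    (Yprev Y Ynext : ℂ → Matrix (Fin 2) (Fin 2) ℂ)
    (hYprev : EllipticOP.IsRHPSolution τ (n - 1) Yprev)
    (hY : EllipticOP.IsRHPSolution τ n Y)
    (hYnext : EllipticOP.IsRHPSolution τ (n + 1) Ynext)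
    -- the elliptic orthogonal polynomials of degree `n - 1` and `n`, and their norms
    (pprev p : ℂ → ℂ)
    (hpprev : EllipticOP.IsEOP τ (n - 1) pprev)
    (hp : EllipticOP.IsEOP τ n p)
    (hprev h : ℂ)
    (hhprev : hprev = EllipticOP.gammaIntegral τ (fun z => pprev z ^ 2))
    (hh : h = EllipticOP.gammaIntegral τ (fun z => p z ^ 2)) :
    hprev ≠ 0 ∧ h ≠ 0 ∧
    ∃ fprev f fnext : ℂ → ℂ,
      -- `f_m` is the determinant of `Y_m`, of the form `℘ + α_m`
      (∃ αprev α αnext : ℂ,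
        (∀ z, fprev z = EllipticOP.wp τ z + αprev) ∧
        (∀ z, f z = EllipticOP.wp τ z + α) ∧
        (∀ z, fnext z = EllipticOP.wp τ z + αnext)) ∧
      (∀ z ∈ EllipticOP.domain τ,
        (Yprev z).det = fprev z ∧ (Y z).det = f z ∧ (Ynext z).det = fnext z) ∧
      ∃ L : ℂ → Matrix (Fin 2) (Fin 2) ℂ,
        (∀ z, L z = EllipticOP.laxMatrix n hprev h (fprev z) (f z) (fnext z)
          (EllipticOP.wp' τ z)) ∧
        -- `Y' = L Y`
        (∀ z ∈ EllipticOP.domain τ, f z ≠ 0 →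
          ∀ i j, HasDerivAt (fun w => Y w i j) ((L z * Y z) i j) z) ∧
        -- the second-order differential equation for `π_n`
        (∀ z ∉ EllipticOP.latticeSet τ, f z ≠ 0 →
          ((n : ℂ) - 1) * f z + (n : ℂ) * fnext z ≠ 0 →
          deriv (deriv p) z =
            (EllipticOP.wp' τ z / f z
              + (n : ℂ) * deriv (fun w => fnext w / f w) z
                * (((n : ℂ) - 1) + (n : ℂ) * (fnext z / f z))⁻¹) * deriv p z
            + (deriv (fun w => (n : ℂ) * EllipticOP.wp' τ w / (2 * f w)) z
              - (n : ℂ) * deriv (fun w => fnext w / f w) z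
                * ((n : ℂ) * EllipticOP.wp' τ z
                  / (2 * (((n : ℂ) - 1) * f z + (n : ℂ) * fnext z)))
              - (L z).det) * p z) := by
  open EllipticOP in
  obtain ⟨m, rfl⟩ : ∃ m, n = m + 1 := ⟨n - 1, by omega⟩
  rw [Nat.add_sub_cancel] at hDprev hYprev hpprev
  -- This is where $n\ge3$ enters: uniqueness is also applied at index $n-1$, which must be at least
  -- `2`.
  have hm : 2 ≤ m := by omega
  obtain ⟨q, q', r, r', κ₀, γ₀, R₀, hY₀⟩ := hYprev.exists_rows
  obtain ⟨a, b, c, d, κ, γ, R, hY₁⟩ := hY.exists_rows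
  obtain ⟨A, B, C, D, κ', γ', R', hY₂⟩ := hYnext.exists_rows
  obtain ⟨α₀, hf₀⟩ := R₀.exists_det_eq
  obtain ⟨α, hf⟩ := R.exists_det_eq
  obtain ⟨α', hf'⟩ := R'.exists_det_eq
  have hsys := fun {z} => R₀.det_mul_deriv_eq R R' hm hDprev hD hf₀ hf hf' (z := z)
  obtain ⟨hγ, -⟩ := R₀.next_snd_eq hm hDprev R
  obtain ⟨hγ', -⟩ := R.next_snd_eq (by omega) hD R'
  have hpa := R.eq_of_isEOP (by omega) hD hp
  have hpi : (2 * Real.pi * Complex.I : ℂ) ≠ 0 := Complex.two_pi_I_ne_zero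
  have hh' : h = 2 * Real.pi * Complex.I * κ := by
    rw [hh, gammaIntegral_congr fun z hz => by rw [hpa z hz], R.gammaIntegral_sq]
  have hhprev' : hprev = 2 * Real.pi * Complex.I * κ₀ := by
    rw [hhprev, gammaIntegral_congr fun z hz => by
      rw [R₀.eq_of_isEOP hm hDprev hpprev z hz], R₀.gammaIntegral_sq]
  have hκ₀ : κ₀ ≠ 0 := right_ne_zero_of_mul_eq_one hγ
  have hκ : κ ≠ 0 := right_ne_zero_of_mul_eq_one hγ'
  have c1 : h / (2 * Real.pi * Complex.I) = κ := by rw [hh', mul_div_cancel_left₀ _ hpi]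
  have c2 : 2 * Real.pi * Complex.I / hprev = γ := by
    rw [hhprev', eq_comm, eq_div_iff (mul_ne_zero hpi hκ₀)]
    linear_combination (2 * Real.pi * Complex.I) * hγ
  refine ⟨hhprev' ▸ mul_ne_zero hpi hκ₀, hh' ▸ mul_ne_zero hpi hκ, fun z => wp τ z + α₀,
    fun z => wp τ z + α, fun z => wp τ z + α', ⟨α₀, α, α', fun _ => rfl, fun _ => rfl,
    fun _ => rfl⟩, fun z hz => ?_, fun z => laxMatrix (m + 1 : ℕ) hprev h (wp τ z + α₀) (wp τ z + α)
    (wp τ z + α') (wp' τ z), fun _ => rfl, fun z hz hfz => ?_, fun z hz hfz hT => ?_⟩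
  · have hz' := (mem_domain.1 hz).1
    rw [hY₀ z hz, hY₁ z hz, hY₂ z hz, Matrix.det_fin_two_of, Matrix.det_fin_two_of,
      Matrix.det_fin_two_of]
    refine ⟨?_, ?_, ?_⟩
    · linear_combination hf₀ z hz'
    · linear_combination hf z hz'
    · linear_combination hf' z hz'
  · obtain ⟨hz', hzc⟩ := mem_domain.1 hz
    obtain ⟨ha, hb, hc, hd⟩ := hsys hz'
    have hinv : (wp τ z + α)⁻¹ * (wp τ z + α) = 1 := inv_mul_cancel₀ hfz
    -- The strip index is locally constant, so near `z` the second column of $Y$ is a fixed linear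
    -- combination of the continued columns and solves the same system.
    have near : ∀ᶠ w in 𝓝 z, Y w = !![a w, b w + stripIndex τ z * a w;
        c w, d w + stripIndex τ z * c w] := by
      filter_upwards [(isOpen_domain τ).mem_nhds hz, eventually_stripIndex_eq hzc] with w h1 h2
      rw [hY₁ w h1, h2.2]
    have hda := (R.fst.differentiableAt_left hz').hasDerivAt
    have hdb := (R.fst.differentiableAt_right hz').hasDerivAt
    have hdc := (R.snd.differentiableAt_left hz').hasDerivAt
    have hdd := (R.snd.differentiableAt_right hz').hasDerivAt
    have key : ∀ i j, HasDerivAt (fun w => (!![a w, b w + stripIndex τ z * a w;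
        c w, d w + stripIndex τ z * c w] : Matrix (Fin 2) (Fin 2) ℂ) i j)
        ((laxMatrix (m + 1 : ℕ) hprev h (wp τ z + α₀) (wp τ z + α) (wp τ z + α') (wp' τ z) *
          Y z) i j) z := by
      rw [hY₁ z hz]
      simp only [laxMatrix, c1, c2]
      intro i j
      fin_cases i <;> fin_cases j
      · convert! hda using 1
        simp only [Fin.zero_eta, Matrix.mul_apply, Fin.sum_univ_two, Matrix.smul_apply,
          Matrix.of_apply, Matrix.cons_val_zero, Matrix.cons_val_one, smul_eq_mul, one_div]
        push_cast
        linear_combination -(wp τ z + α)⁻¹ * ha + deriv a z * hinv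
      · convert! hdb.add (hda.const_mul _) using 1
        simp only [Fin.zero_eta, Fin.mk_one, Matrix.mul_apply, Fin.sum_univ_two, Matrix.smul_apply,
          Matrix.of_apply, Matrix.cons_val_zero, Matrix.cons_val_one, smul_eq_mul, one_div]
        push_cast
        linear_combination -(wp τ z + α)⁻¹ * (hb + stripIndex τ z * ha) +
          (deriv b z + stripIndex τ z * deriv a z) * hinv
      · convert! hdc using 1
        simp only [Fin.zero_eta, Fin.mk_one, Matrix.mul_apply, Fin.sum_univ_two, Matrix.smul_apply,
          Matrix.of_apply, Matrix.cons_val_zero, Matrix.cons_val_one, smul_eq_mul, one_div]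
        push_cast
        linear_combination -(wp τ z + α)⁻¹ * hc + deriv c z * hinv
      · convert! hdd.add (hdc.const_mul _) using 1
        simp only [Fin.mk_one, Matrix.mul_apply, Fin.sum_univ_two, Matrix.smul_apply,
          Matrix.of_apply, Matrix.cons_val_zero, Matrix.cons_val_one, smul_eq_mul, one_div]
        push_cast
        linear_combination -(wp τ z + α)⁻¹ * (hd + stripIndex τ z * hc) +
          (deriv d z + stripIndex τ z * deriv c z) * hinv
    intro i j
    refine (key i j).congr_of_eventuallyEq ?_
    filter_upwards [near] with w hw
    rw [hw]
  · have hU := (isOpen_compl_latticeSet τ).mem_nhds hz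
    -- The given polynomial and `a` agree on the open complement of the lattice, so their
    -- derivatives agree there too.
    have hpU : p =ᶠ[𝓝 z] a := by filter_upwards [hU] with w hw using hpa w hw
    have hwd := (isElliptic_wp τ).differentiableAt hz
    have hwd' := (isElliptic_wp' τ).differentiableAt hz
    have hfd : DifferentiableAt ℂ (fun w => wp τ w + α) z := hwd.add_const α
    have hf0 : ∀ᶠ w in 𝓝 z, wp τ w + α ≠ 0 := hfd.continuousAt.eventually_ne hfz
    rw [hpU.deriv.deriv_eq, hpU.deriv_eq, hpa z hz]
    have hdet : (laxMatrix (m + 1 : ℕ) hprev h (wp τ z + α₀) (wp τ z + α) (wp τ z + α')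
        (wp' τ z)).det = ((m + 1 : ℕ) : ℂ) * wp' τ z / (2 * (wp τ z + α)) *
          ((1 - m) / 2 * wp' τ z / (wp τ z + α)) -
        κ * ((((m + 1 : ℕ) : ℂ) - 1) + ((m + 1 : ℕ) : ℂ) * ((wp τ z + α') / (wp τ z + α))) *
          (γ * ((1 - m) * (wp τ z + α₀) - m * (wp τ z + α)) / (wp τ z + α)) := by
      simp only [laxMatrix, c1, c2, Matrix.det_smul, Matrix.det_fin_two_of, Fintype.card_fin]
      push_cast
      field_simp
      ring
    rw [hdet]
    refine deriv_deriv_eq_of_system (c := c) (f := fun w => wp τ w + α)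
      (f' := fun w => wp τ w + α') (D := wp' τ) (N := ((m + 1 : ℕ) : ℂ))
      (fun _ => rfl) (fun _ => rfl)
      ((hwd'.const_mul _).div (hfd.const_mul 2) (mul_ne_zero two_ne_zero hfz))
      ((hwd.add_const α').div hfd hfz) (R.fst.differentiableAt_left hz)
      (R.snd.differentiableAt_left hz) ?_ ?_ ?_ hfz hT
    · filter_upwards [hU, hf0] with w hw hw0
      have := (hsys hw).1
      push_cast
      field_simp
      linear_combination 2 * this
    · have := (hsys hz).2.2.1
      field_simp
      linear_combination 2 * this
    · push_cast
      field_simp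
      ring
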